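/- Let $x=(x_k)_{k\ge1}$ and $z=(z_k)_{k\ge1}$ be zero-mean, jointly Gaussian, jointly stationary real processes, and write $y_a^b=(y_a,\dots,y_b)$, $y^k=y_1^k$. Let $m\ge1$ and suppose that $z$ is partially Markov of order $m$, i.e. almost surely $P(z_{k+1}\mid x^k,z^k)=P(z_{k+1}\mid x_{k-m+1}^k,z_{k-m+1}^k)$ for all $k\ge 1$ (windows being cut off at time $1$), and that for every $k\ge m$ there is no deterministic (affine) relationship between the components of $[x_{k-m+1}^k\ \ z^k]$. Say that $x$ Granger causes $z$ if for some $k\ge m$ the conditional distributions $P(z_{k+1}\mid x_{k-m+1}^k,z_{k-m+1}^k)$ and $P(z_{k+1}\mid z^k)$ differ with positive probability. Let $\gamma_x,\gamma_z$ be the standard deviations of $x_k$ and $z_k$ and $\rho_{xz}(i-j)$, $\rho_{zz}(i-j)$ the correlation coefficients of $x_i,z_j$ and of $z_i,z_j$. Let $0<\underline\gamma_x\le\gamma_x\le\overline\gamma_x$, $0<\underline\gamma_z\le\gamma_z\le\overline\gamma_z$, $|\rho_{xz}(\kappa)|\le\overline\rho_{xz}<1$ for all lags $\kappa$, and $|\rho_{zz}(\kappa)|\le\overline\rho_{zz}<1$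 for all lags $\kappa\ne0$. Let $x^Q,z^Q$ be obtained from $x,z$ by infinite-level uniform mid-tread quantizers (rounding to the nearest integer multiple of the step) with steps $0<\Delta_x<2\pi\underline\gamma_x$ and $0<\Delta_z<2\pi\underline\gamma_z$. For $m\le q\le k$ let $C^{x^Q\to z^Q}(m,q)$ be the $(m+1)\times(m+q)$ matrix of covariances of $(z^Q)_{k-m+1}^{k+1}$ (rows) with $\big((x^Q)_{k-m+1}^{k},(z^Q)_{k-m+1}^{k},(z^Q)_{k-q+1}^{k-m}\big)$ (columns); by stationarity it does not depend on $k$. Put $$s_x=\frac{2\pi^2\underline\gamma_x^2}{\Delta_x^2},\quad s_z=\frac{2\pi^2\underline\gamma_z^2}{\Delta_z^2},\quad s_{xz}=\frac{4\pi^2\underline\gamma_x\underline\gamma_z(1-\overline\rho_{xz})}{\Delta_x\Delta_z},\quad s_{zz}=\frac{4\pi^2\underline\gamma_z^2(1-\overline\rho_{zz})}{\Delta_z^2},$$ $$\varrho_1=4\underline\gamma_z^2(1-\overline\rho_{zz})\frac{\zeta(s_{zz}+1)^2}{s_{zz}e^{s_{zz}}}+4\overline\rho_{zz}\underline\gamma_z^2\frac{\zeta(2s_z)}{e^{s_z}},$$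 $$\varrho_2=2\Big(\overline\rho_{xz}\Big(\overline\gamma_x\underline\gamma_z\frac{\zeta(2s_z)}{e^{s_z}}+\overline\gamma_z\underline\gamma_x\frac{\zeta(2s_x)}{e^{s_x}}\Big)+2(1-\overline\rho_{xz})\underline\gamma_z\underline\gamma_x\frac{\zeta(s_{xz}+1)^2}{s_{xz}e^{s_{xz}}}\Big),$$ $$\varrho_3=\frac{\Delta_z^2}{12}+\frac{\Delta_z^2}{\pi^2e^{s_z}}\zeta(2s_z+2)+\frac{4\overline\gamma_z^2}{2^{s_z}e^{s_z}}\zeta(2s_z),$$ $$N_\infty=\varrho_1(q-1)+\varrho_2m+\max\{\varrho_1,\varrho_3\},\qquad N_1=\max\{\varrho_1(m+1),\ \varrho_2(m+1),\ \varrho_1m+\varrho_3\},$$ with $\zeta$ the Riemann zeta function. If for some $q\in[m,k]$ the matrix $C^{x^Q\to z^Q}(m,q)$ has full rank $m+1$ and $\sqrt{N_\infty N_1}<\sigma_{\min}^Q$, where $\sigma_{\min}^Q$ is its smallest singular value, then $x$ Granger causes $z$. -/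

import Mathlib

open MeasureTheory ProbabilityTheory

noncomputable section

namespace Granger

variable {Ω : Type*} [MeasurableSpace Ω]

/-! Scalar processes are functions `y : ℕ → Ω → ℝ` on the time axis `k = 1, 2, …`; the entry at
index `0` is never used. -/

/-- The block `(y_i, y_{i+1}, …, y_{i+n-1})` of `n` consecutive values starting at time `i`. -/
def window (y : ℕ → Ω → ℝ) (i n : ℕ) : Ω → Fin n → ℝ := fun ω j => y (i + j) ω

/-- The bivariate process `(x_k, z_k)`, `k = 1, 2, …`, as a sequence: entry `n` is time `n + 1`. -/
def pairProcess (x z : ℕ → Ω → ℝ) : ℕ → Ω → ℝ × ℝ := fun n ω => (x (n + 1) ω, z (n + 1) ω)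

/-- Strict joint stationarity: the law of the whole sequence is invariant under time shifts. -/
def JointlyStationary (μ : Measure Ω) (x z : ℕ → Ω → ℝ) : Prop :=
  ∀ k : ℕ, μ.map (fun ω n => pairProcess x z n ω) = μ.map (fun ω n => pairProcess x z (k + n) ω)

/-- Almost surely, the conditional distribution of `Y` given `U` and the conditional distribution
of `Y` given `V` are the same probability measure: `P(Y | U) = P(Y | V)` with probability one. -/
def CondLawEq (μ : Measure Ω) [IsFiniteMeasure μ] {S T : Type*} [MeasurableSpace S]
    [MeasurableSpace T] (Y : Ω → ℝ) (U : Ω → S) (V : Ω → T) : Prop :=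
  ∀ᵐ ω ∂μ, condDistrib Y U μ (U ω) = condDistrib Y V μ (V ω)

/-- `z` is partially Markov of order `m` in `x` and `z`:
`P(z_{k+1} | x^k, z^k) = P(z_{k+1} | x_{k-m+1}^k, z_{k-m+1}^k)`. For `k < m` the windows, cut off at
time `1`, are the whole past and there is nothing to require. -/
def PartiallyMarkov (μ : Measure Ω) [IsFiniteMeasure μ] (m : ℕ) (x z : ℕ → Ω → ℝ) : Prop :=
  ∀ k : ℕ, m ≤ k →
    CondLawEq μ (z (k + 1))
      (fun ω => (window x 1 k ω, window z 1 k ω))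
      (fun ω => (window x (k - m + 1) m ω, window z (k - m + 1) m ω))

/-- `x` Granger causes `z` (with partial Markov order `m`): for some `k ≥ m` it is not true that
`P(z_{k+1} | x_{k-m+1}^k, z_{k-m+1}^k) = P(z_{k+1} | z^k)` with probability one. -/
def GrangerCauses (μ : Measure Ω) [IsFiniteMeasure μ] (m : ℕ) (x z : ℕ → Ω → ℝ) : Prop :=
  ∃ k : ℕ, m ≤ k ∧
    ¬ CondLawEq μ (z (k + 1))
      (fun ω => (window x (k - m + 1) m ω, window z (k - m + 1) m ω))
      (window z 1 k)

/-- There is no deterministic (affine) relationship between the components of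
`[x_{k-m+1}^k, z^k]`, at any time `k ≥ m`. -/
def NoDeterministicRelation (μ : Measure Ω) (m : ℕ) (x z : ℕ → Ω → ℝ) : Prop :=
  ∀ k : ℕ, m ≤ k → ∀ (a : Fin m → ℝ) (b : Fin k → ℝ) (c : ℝ),
    (∀ᵐ ω ∂μ, ∑ i, a i * window x (k - m + 1) m ω i + ∑ j, b j * window z 1 k ω j = c) →
      a = 0 ∧ b = 0

/-- Standard deviation. -/
def stdDev (μ : Measure Ω) (X : Ω → ℝ) : ℝ := √(Var[X; μ])

/-- Correlation coefficient. -/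
def corr (μ : Measure Ω) (X Y : Ω → ℝ) : ℝ := cov[X, Y; μ] / (stdDev μ X * stdDev μ Y)

/-- The infinite-level uniform (mid-tread) quantizer with step `Δ`: rounding to the nearest
integer multiple of `Δ`. -/
def quantizer (Δ : ℝ) (w : ℝ) : ℝ := Δ * round (w / Δ)

/-- The process `y` passed through the quantizer with step `Δ`. -/
def quantized (Δ : ℝ) (y : ℕ → Ω → ℝ) : ℕ → Ω → ℝ := fun k ω => quantizer Δ (y k ω)

/-- The cross-covariance matrix of two random vectors. -/
def crossCov (μ : Measure Ω) {a b : ℕ} (U : Ω → Fin a → ℝ) (V : Ω → Fin b → ℝ) :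
    Matrix (Fin a) (Fin b) ℝ :=
  Matrix.of fun i j => cov[fun ω => U ω i, fun ω => V ω j; μ]

/-- The `(m+1) × (q+m)` matrix `[Γ_{z*, x~}  Γ_{z*, z~}  Γ_{z*, z°}]` formed at time `k`, where
`z* = z_{k-m+1}^{k+1}`, `x~ = x_{k-m+1}^k`, `z~ = z_{k-m+1}^k` and `z° = z_{k-q+1}^{k-m}`
(for `m ≤ q ≤ k`). -/
def covMatrix (μ : Measure Ω) (x z : ℕ → Ω → ℝ) (m q k : ℕ) :
    Matrix (Fin (m + 1)) (Fin m ⊕ (Fin m ⊕ Fin (q - m))) ℝ :=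
  Matrix.fromCols
    (crossCov μ (window z (k - m + 1) (m + 1)) (window x (k - m + 1) m))
    (Matrix.fromCols
      (crossCov μ (window z (k - m + 1) (m + 1)) (window z (k - m + 1) m))
      (crossCov μ (window z (k - m + 1) (m + 1)) (window z (k - q + 1) (q - m))))

/-- The smallest of the `min (#rows) (#columns)` singular values of a real matrix. Mathlib lists
the singular values of a linear map in decreasing order, starting from index `0`. -/
def sigmaMin {r c : Type*} [Fintype r] [Fintype c] [DecidableEq c] (M : Matrix r c ℝ) : ℝ :=
  (Matrix.toEuclideanLin M).singularValues (min (Fintype.card r) (Fintype.card c) - 1)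

/-- The Riemann zeta function at a real argument. -/
def zeta (s : ℝ) : ℝ := (riemannZeta (s : ℂ)).re

/-- `s_x = 2π² γ² / Δ²` (and `s_z`), for a lower bound `γ` on the standard deviation. -/
def sOne (γ Δ : ℝ) : ℝ := 2 * Real.pi ^ 2 * γ ^ 2 / Δ ^ 2

/-- `s_{xz} = 4π² γ_x γ_z (1 - ρ) / (Δ_x Δ_z)` (and `s_{zz}`, on taking `x = z`). -/
def sTwo (γ₁ γ₂ ρ Δ₁ Δ₂ : ℝ) : ℝ := 4 * Real.pi ^ 2 * γ₁ * γ₂ * (1 - ρ) / (Δ₁ * Δ₂)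

/-- Bound for the perturbation of the autocovariances of `z` at nonzero lags; `lz` is the lower
bound on the standard deviation of `z`. -/
def varrho1 (lz ρzz Δz : ℝ) : ℝ :=
  4 * lz ^ 2 * (1 - ρzz) *
      (zeta (sTwo lz lz ρzz Δz Δz + 1) ^ 2 /
        (sTwo lz lz ρzz Δz Δz * Real.exp (sTwo lz lz ρzz Δz Δz)))
    + 4 * ρzz * lz ^ 2 * (zeta (2 * sOne lz Δz) / Real.exp (sOne lz Δz))

/-- Bound for the perturbation of the cross-covariances of `x` and `z`; `lx, ux` and `lz, uz` are
the lower and upper bounds on the standard deviations of `x` and `z`. -/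
def varrho2 (lx ux lz uz ρxz Δx Δz : ℝ) : ℝ :=
  2 * (ρxz * (ux * lz * (zeta (2 * sOne lz Δz) / Real.exp (sOne lz Δz))
        + uz * lx * (zeta (2 * sOne lx Δx) / Real.exp (sOne lx Δx)))
    + 2 * (1 - ρxz) * lz * lx *
        (zeta (sTwo lx lz ρxz Δx Δz + 1) ^ 2 /
          (sTwo lx lz ρxz Δx Δz * Real.exp (sTwo lx lz ρxz Δx Δz))))

/-- Bound for the perturbation of the variance of `z`. -/
def varrho3 (lz uz Δz : ℝ) : ℝ :=
  Δz ^ 2 / 12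
    + Δz ^ 2 / (Real.pi ^ 2 * Real.exp (sOne lz Δz)) * zeta (2 * sOne lz Δz + 2)
    + 4 * uz ^ 2 / ((2 : ℝ) ^ (sOne lz Δz) * Real.exp (sOne lz Δz)) * zeta (2 * sOne lz Δz)

/-- `N_∞ = ϱ₁ (q - 1) + ϱ₂ m + max {ϱ₁, ϱ₃}`. -/
def NInf (m q : ℕ) (t1 t2 t3 : ℝ) : ℝ := t1 * ((q : ℝ) - 1) + t2 * m + max t1 t3

/-- `N_1 = max {ϱ₁ (m + 1), ϱ₂ (m + 1), ϱ₁ m + ϱ₃}`. -/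
def NOne (m : ℕ) (t1 t2 t3 : ℝ) : ℝ :=
  max (t1 * ((m : ℝ) + 1)) (max (t2 * ((m : ℝ) + 1)) (t1 * m + t3))

end Granger

end

noncomputable section

namespace Granger

open Filter Topology Module

/-! ### Real values of the zeta function and elementary series -/

/-! Argue by contradiction. If `x` does not Granger cause `z`, then at time `k` the conditional mean
of `z (k + 1)` given the two windows of length `m` equals its conditional mean given `z^k`. For
Gaussian variables both are linear regressions, and since the regressors satisfy no affine relation
their coefficients must agree: only the last `m` values of `z` carry weight, with coefficients `b`.
The residual of `z (k + 1)` is then uncorrelated with the `x`-window and with all of `z^k`, so `(-b,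
1)` is a left null vector of the unquantized matrix `C` (`exists_regression_of_not_grangerCauses`,
`exists_left_null_covMatrix`).

Let `E` be the quantized matrix minus `C`. On that null vector the quantized matrix acts as `E`, so
its smallest singular value is at most the spectral norm of `E`, which Schur's test bounds by the
geometric mean of the largest absolute row sum and the largest absolute column sum
(`sigmaMin_le_of_left_null`). It remains to bound the entries of `E` by the three constants
`varrho1`, `varrho2`, `varrho3`; the row and column sums are then at most `NInf` and `NOne`, against
the assumed strict inequality.

For the entries, the quantization error is a sawtooth with Fourier series `(Δ/π) ∑ (-1)^n
sin(2πnw/Δ)/n`. This converges only conditionally, so it is replaced by its Abel means, which are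
uniformly bounded, can be integrated term by term, and converge off a null set as `r` tends to 1
from below. Gaussian trigonometric moments turn the terms into exponentials. Single sums become
alternating series with rapidly decreasing terms (`integral_mul_quantError`), and the double sum is
dominated by a product of two zeta series (`abs_integral_quantError_mul_quantError_le`). -/

lemma hasSum_zeta {s : ℝ} (hs : 1 < s) :
    HasSum (fun n : ℕ => ((n : ℝ) + 1) ^ (-s)) (zeta s) := by
  have hsum : Summable (fun n : ℕ => ((n : ℝ) + 1) ^ (-s)) := by
    have := (summable_nat_add_iff 1).2 (Real.summable_nat_rpow.2 (by linarith : -s < -1))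
    simpa using this
  have h1 : riemannZeta (s : ℂ) = ((∑' n : ℕ, ((n : ℝ) + 1) ^ (-s) : ℝ) : ℂ) := by
    rw [zeta_eq_tsum_one_div_nat_add_one_cpow (by simpa using hs), Complex.ofReal_tsum]
    refine tsum_congr fun n => ?_
    rw [Complex.ofReal_cpow (by positivity)]
    push_cast
    rw [Complex.cpow_neg, one_div]
  have h2 : zeta s = ∑' n : ℕ, ((n : ℝ) + 1) ^ (-s) := by
    rw [zeta, h1, Complex.ofReal_re]
  rw [h2]
  exact hsum.hasSum

lemma one_add_two_rpow_le_zeta {s : ℝ} (hs : 1 < s) : 1 + (2 : ℝ) ^ (-s) ≤ zeta s := by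
  have h := sum_le_hasSum (Finset.range 2) (fun n _ => by positivity) (hasSum_zeta hs)
  norm_num [Finset.sum_range_succ] at h
  exact h

lemma one_le_zeta {s : ℝ} (hs : 1 < s) : 1 ≤ zeta s := by
  have := one_add_two_rpow_le_zeta hs
  have : (0 : ℝ) ≤ (2 : ℝ) ^ (-s) := by positivity
  linarith

/-- This is `log t ≤ t - 1` multiplied by `s` and exponentiated. With `t` a product of two integers,
the right side splits into a product of powers, which lets the double series factor. -/
lemma exp_neg_mul_le_exp_neg_mul_rpow {t s : ℝ} (ht : 1 ≤ t) (hs : 0 ≤ s) :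
    Real.exp (-(t * s)) ≤ Real.exp (-s) * t ^ (-s) := by
  rw [Real.rpow_def_of_pos (by linarith), ← Real.exp_add]
  apply Real.exp_le_exp.2
  nlinarith [Real.log_le_sub_one_of_pos (by linarith : 0 < t)]

lemma alternating_hasSum_mem {f : ℕ → ℝ} {l : ℝ} (hf : Antitone f)
    (h : HasSum (fun n => (-1) ^ n * f n) l) : 0 ≤ l ∧ l ≤ f 0 := by
  have ht := h.tendsto_sum_nat
  exact ⟨by simpa using hf.alternating_series_le_tendsto ht 0,
    by simpa using hf.tendsto_le_alternating_series ht 0⟩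

/-! ### The quantization error and its Abel means -/

/-- The error committed by the quantizer. -/
def quantError (Δ w : ℝ) : ℝ := quantizer Δ w - w

/-- The Abel means of the Fourier series of the quantization error. -/
def abelError (Δ r w : ℝ) : ℝ :=
  Δ / Real.pi * -(1 + r * Complex.exp ((2 * Real.pi * w / Δ : ℝ) * Complex.I)).arg

/-- The Fourier coefficients in the Abel means of the quantization error. -/
def abelCoeff (Δ r : ℝ) (n : ℕ) : ℝ := Δ / Real.pi * ((-1) ^ (n + 1) * r ^ (n + 1) / (n + 1))

lemma abs_quantError_le {Δ : ℝ} (hΔ : 0 < Δ) (w : ℝ) : |quantError Δ w| ≤ Δ / 2 := by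
  have h : quantError Δ w = -(Δ * (w / Δ - round (w / Δ))) := by
    unfold quantError quantizer; field_simp; ring
  rw [h, abs_neg, abs_mul, abs_of_pos hΔ]
  nlinarith [abs_sub_round (w / Δ)]

lemma measurable_quantizer (Δ : ℝ) : Measurable (quantizer Δ) := by
  unfold quantizer
  have : Measurable (fun w : ℝ => ((round (w / Δ) : ℤ) : ℝ)) := by
    simp_rw [round_eq]
    exact (measurable_from_top (f := fun z : ℤ => (z : ℝ))).comp
      (Int.measurable_floor.comp (by fun_prop))
  fun_prop

lemma measurable_quantError (Δ : ℝ) : Measurable (quantError Δ) :=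
  (measurable_quantizer Δ).sub measurable_id

lemma measurable_abelError (Δ r : ℝ) : Measurable (abelError Δ r) := by
  unfold abelError
  refine Measurable.const_mul (Measurable.neg (Complex.measurable_arg.comp ?_)) _
  fun_prop

lemma norm_ofReal_mul_exp {r : ℝ} (hr : 0 ≤ r) (θ : ℝ) :
    ‖(r : ℂ) * Complex.exp (θ * Complex.I)‖ = r := by
  rw [norm_mul, Complex.norm_exp_ofReal_mul_I, Complex.norm_real, Real.norm_of_nonneg hr, mul_one]

lemma hasSum_abelError (Δ w : ℝ) {r : ℝ} (hr0 : 0 ≤ r) (hr1 : r < 1) :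
    HasSum (fun n : ℕ => abelCoeff Δ r n * Real.sin ((n + 1) * (2 * Real.pi / Δ) * w))
      (abelError Δ r w) := by
  set θ : ℝ := 2 * Real.pi * w / Δ with hθ
  have hz : ‖-((r : ℂ) * Complex.exp (θ * Complex.I))‖ < 1 := by
    rw [norm_neg, norm_ofReal_mul_exp hr0]; exact hr1
  have h := (Complex.hasSum_im (Complex.hasSum_taylorSeries_neg_log' hz)).mul_left (Δ / Real.pi)
  rw [sub_neg_eq_add, Complex.neg_im, Complex.log_im] at h
  change HasSum _ (abelError Δ r w) at h
  convert! h using 2 with n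
  have hpow : (-((r : ℂ) * Complex.exp (θ * Complex.I))) ^ (n + 1) / ((n : ℂ) + 1)
      = (((-1) ^ (n + 1) * r ^ (n + 1) / (n + 1) : ℝ) : ℂ)
        * Complex.exp (((n + 1) * θ : ℝ) * Complex.I) := by
    rw [neg_pow, mul_pow, ← Complex.exp_nat_mul]
    push_cast
    rw [show ((n : ℂ) + 1) * (θ * Complex.I) = (n + 1) * θ * Complex.I by ring]
    ring
  rw [hpow, Complex.im_ofReal_mul, Complex.exp_ofReal_mul_I_im, abelCoeff, hθ]
  rw [show ((n : ℝ) + 1) * (2 * Real.pi * w / Δ) = (n + 1) * (2 * Real.pi / Δ) * w by ring]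
  ring

lemma abs_abelError_le {Δ : ℝ} (hΔ : 0 < Δ) (w : ℝ) {r : ℝ} (hr0 : 0 ≤ r) (hr1 : r < 1) :
    |abelError Δ r w| ≤ Δ / 2 := by
  -- As `r < 1`, the point `1 + r e^{iθ}` stays in the right half-plane. This makes the bound
  -- uniform in `r`.
  have h : |(1 + r * Complex.exp ((2 * Real.pi * w / Δ : ℝ) * Complex.I)).arg| ≤ Real.pi / 2 := by
    rw [Complex.abs_arg_le_pi_div_two_iff]
    have := (Complex.abs_re_le_norm
      ((r : ℂ) * Complex.exp ((2 * Real.pi * w / Δ : ℝ) * Complex.I))).trans_eq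
        (norm_ofReal_mul_exp hr0 _)
    rw [Complex.add_re, Complex.one_re]
    linarith [(abs_le.1 this).1]
  unfold abelError
  rw [abs_mul, abs_neg, abs_of_pos (by positivity)]
  calc _ ≤ Δ / Real.pi * (Real.pi / 2) := by gcongr
    _ = Δ / 2 := by field_simp

/-- With `f` the signed distance of `w / Δ` to its rounding, `1 + e^{2πif} = 2 cos(πf) e^{iπf}` has
argument `πf` when `|f| < 1/2`. The excluded points are the jumps of the sawtooth, where `|f| = 1/2`
and the limit point 0 lies on the cut of `arg`. -/
lemma tendsto_abelError {Δ : ℝ} (hΔ : 0 < Δ) {w : ℝ}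
    (hw : ∀ n : ℤ, w ≠ Δ * (n + 1 / 2)) :
    Tendsto (fun r => abelError Δ r w) (𝓝[<] 1) (𝓝 (quantError Δ w)) := by
  set f : ℝ := w / Δ - round (w / Δ) with hf
  have hf1 : |f| ≤ 1 / 2 := abs_sub_round _
  have hf2 : |f| < 1 / 2 := by
    refine lt_of_le_of_ne hf1 fun h => ?_
    rcases abs_eq (by norm_num : (0 : ℝ) ≤ 1 / 2) |>.1 h with h | h
    · refine hw (round (w / Δ)) ?_
      rw [← h, hf]; field_simp; ring
    · refine hw (round (w / Δ) - 1) ?_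
      have : w = Δ * (round (w / Δ) + f) := by rw [hf]; field_simp; ring
      rw [h] at this
      push_cast
      linarith
  have hfl := abs_lt.1 hf2
  have hcos : 0 < Real.cos (Real.pi * f) := by
    apply Real.cos_pos_of_mem_Ioo
    constructor <;> nlinarith [Real.pi_pos]
  have hexp : Complex.exp ((2 * Real.pi * w / Δ : ℝ) * Complex.I)
      = Complex.exp ((2 * Real.pi * f : ℝ) * Complex.I) := by
    rw [Complex.exp_eq_exp_iff_exists_int]
    refine ⟨round (w / Δ), ?_⟩
    rw [hf]; push_cast; ring
  have hfac : 1 + Complex.exp ((2 * Real.pi * f : ℝ) * Complex.I)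
      = (2 * Real.cos (Real.pi * f) : ℝ) * (Complex.cos (Real.pi * f : ℝ)
        + Complex.sin (Real.pi * f : ℝ) * Complex.I) := by
    rw [show (2 * Real.pi * f : ℝ) = 2 * (Real.pi * f) by ring, Complex.exp_mul_I,
      ← Complex.ofReal_cos, ← Complex.ofReal_sin, ← Complex.ofReal_cos, ← Complex.ofReal_sin,
      Real.cos_two_mul, Real.sin_two_mul]
    push_cast; ring
  have harg : (1 + Complex.exp ((2 * Real.pi * w / Δ : ℝ) * Complex.I)).arg = Real.pi * f := by
    rw [hexp, hfac]
    apply Complex.arg_mul_cos_add_sin_mul_I (by positivity)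
    constructor <;> nlinarith [Real.pi_pos]
  have hval : quantError Δ w
      = Δ / Real.pi * -(1 + Complex.exp ((2 * Real.pi * w / Δ : ℝ) * Complex.I)).arg := by
    rw [harg, hf]; unfold quantError quantizer
    have := Real.pi_ne_zero
    field_simp; ring
  have hslit : (1 + Complex.exp ((2 * Real.pi * w / Δ : ℝ) * Complex.I)) ∈ Complex.slitPlane := by
    left
    rw [hexp, hfac, ← Complex.ofReal_cos, ← Complex.ofReal_sin]
    simp only [Complex.mul_re, Complex.ofReal_re, Complex.add_re, Complex.ofReal_im, Complex.I_re,
      Complex.I_im, mul_zero, zero_mul, sub_zero, add_zero]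
    positivity
  rw [hval]
  refine Tendsto.mono_left ?_ nhdsWithin_le_nhds
  refine Tendsto.const_mul _ (Tendsto.neg ?_)
  refine (Complex.continuousAt_arg hslit).tendsto.comp ?_
  have : Continuous (fun r : ℝ => 1 + (r : ℂ) * Complex.exp ((2 * Real.pi * w / Δ : ℝ) * Complex.I))
      := by fun_prop
  simpa using this.tendsto 1

lemma hasSum_sq_quantError {Δ : ℝ} (hΔ : 0 < Δ) (w : ℝ) :
    HasSum (fun n : ℕ => Δ ^ 2 / Real.pi ^ 2 * ((-1) ^ (n + 1) / ((n : ℝ) + 1) ^ 2)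
      * Real.cos ((n + 1) * (2 * Real.pi / Δ) * w)) (quantError Δ w ^ 2 - Δ ^ 2 / 12) := by
  set f : ℝ := w / Δ - round (w / Δ) with hf
  have hf1 := abs_le.1 (abs_sub_round (w / Δ))
  -- The squared sawtooth is, up to scale and constant, the Bernoulli polynomial `B₂` at `f + 1/2`;
  -- the half shift produces the signs `(-1)^(n+1)`. The term `n = 0` is zero, as division by zero
  -- gives zero, and is dropped.
  have h := hasSum_one_div_nat_pow_mul_cos (k := 1) one_ne_zero
    (x := f + 1 / 2) ⟨by linarith [hf1.1], by linarith [hf1.2]⟩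
  rw [← hasSum_nat_add_iff' 1] at h
  have h' := h.mul_left (Δ ^ 2 / Real.pi ^ 2)
  have hw : w = Δ * (round (w / Δ) + f) := by rw [hf]; field_simp; ring
  have hπ := Real.pi_ne_zero
  convert! h' using 1
  · funext n
    have hc : Real.cos (2 * Real.pi * ((n + 1 : ℕ) : ℝ) * (f + 1 / 2))
        = (-1) ^ (n + 1) * Real.cos ((n + 1) * (2 * Real.pi / Δ) * w) := by
      rw [show 2 * Real.pi * ((n + 1 : ℕ) : ℝ) * (f + 1 / 2)
          = 2 * Real.pi * (n + 1) * f + ((n + 1 : ℕ) : ℝ) * Real.pi by push_cast; ring,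
        Real.cos_add_nat_mul_pi]
      congr 1
      rw [show ((n : ℝ) + 1) * (2 * Real.pi / Δ) * w = 2 * Real.pi * (n + 1) * f
          + (((n + 1 : ℕ) * round (w / Δ) : ℤ) : ℝ) * (2 * Real.pi) by
        nth_rewrite 1 [hw]; push_cast; field_simp; ring, Real.cos_add_int_mul_two_pi]
    rw [hc]
    push_cast
    ring
  · have hq : quantError Δ w = -(Δ * f) := by
      rw [hf]; unfold quantError quantizer; field_simp; ring
    rw [hq]
    simp [Polynomial.bernoulli_def, Finset.sum_range_succ, Polynomial.eval_add, bernoulli_two,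
      Nat.factorial]
    field_simp
    ring

variable {Ω : Type*} [MeasurableSpace Ω] {μ : Measure Ω} {X Y : Ω → ℝ}

/-! ### Trigonometric moments of Gaussian variables -/

lemma integral_cos_of_gaussian (hX : HasGaussianLaw X μ) (h0 : ∫ ω, X ω ∂μ = 0) :
    ∫ ω, Real.cos (X ω) ∂μ = Real.exp (-(Var[X; μ] / 2)) ∧ ∫ ω, Real.sin (X ω) ∂μ = 0 := by
  have := hX.isProbabilityMeasure
  have hm := hX.aemeasurable
  have h1 : ∫ ω, Complex.exp (X ω * Complex.I) ∂μ = (Real.exp (-(Var[X; μ] / 2)) : ℂ) := by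
    have h := charFun_gaussianReal (μ := 0) (v := Var[X; μ].toNNReal) 1
    rw [charFun_apply_real] at h
    have hmap := hX.map_eq_gaussianReal
    rw [h0] at hmap
    rw [← hmap, integral_map hm (by fun_prop)] at h
    simp only [Complex.ofReal_one, one_mul] at h
    rw [h, Real.coe_toNNReal _ (variance_nonneg _ _)]
    push_cast
    congr 1
    ring
  have hint : Integrable (fun ω => Complex.exp (X ω * Complex.I)) μ := by
    refine Integrable.of_bound (C := 1) (by fun_prop) (ae_of_all _ fun ω => ?_)
    rw [Complex.norm_exp_ofReal_mul_I]
  constructor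
  · have := integral_re (𝕜 := ℂ) hint
    simp only [RCLike.re_eq_complex_re, Complex.exp_ofReal_mul_I_re] at this
    rw [this]
    exact (congrArg Complex.re h1).trans (Complex.ofReal_re _)
  · have := integral_im (𝕜 := ℂ) hint
    simp only [RCLike.im_eq_complex_im, Complex.exp_ofReal_mul_I_im] at this
    rw [this]
    exact (congrArg Complex.im h1).trans (Complex.ofReal_im _)

lemma hasGaussianLaw_lincomb (hXY : HasGaussianLaw (fun ω => (X ω, Y ω)) μ) (a b : ℝ) :
    HasGaussianLaw (fun ω => a * X ω + b * Y ω) μ :=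
  hXY.map (a • ContinuousLinearMap.fst ℝ ℝ ℝ + b • ContinuousLinearMap.snd ℝ ℝ ℝ)

lemma integral_lincomb (hXY : HasGaussianLaw (fun ω => (X ω, Y ω)) μ)
    (hX0 : ∫ ω, X ω ∂μ = 0) (hY0 : ∫ ω, Y ω ∂μ = 0) (a b : ℝ) :
    ∫ ω, (a * X ω + b * Y ω) ∂μ = 0 := by
  have := hXY.isProbabilityMeasure
  rw [integral_add (hXY.fst.integrable.const_mul a) (hXY.snd.integrable.const_mul b),
    integral_const_mul, integral_const_mul, hX0, hY0]
  simp

lemma variance_lincomb (hXY : HasGaussianLaw (fun ω => (X ω, Y ω)) μ) (a b : ℝ) :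
    Var[fun ω => a * X ω + b * Y ω; μ]
      = a ^ 2 * Var[X; μ] + 2 * a * b * cov[X, Y; μ] + b ^ 2 * Var[Y; μ] := by
  have := hXY.isProbabilityMeasure
  rw [variance_fun_add (hXY.fst.memLp_two.const_mul a) (hXY.snd.memLp_two.const_mul b),
    variance_const_mul, variance_const_mul, covariance_const_mul_left, covariance_const_mul_right]
  ring

lemma integral_cos_lincomb (hXY : HasGaussianLaw (fun ω => (X ω, Y ω)) μ)
    (hX0 : ∫ ω, X ω ∂μ = 0) (hY0 : ∫ ω, Y ω ∂μ = 0) (a b : ℝ) :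
    ∫ ω, Real.cos (a * X ω + b * Y ω) ∂μ
      = Real.exp (-((a ^ 2 * Var[X; μ] + 2 * a * b * cov[X, Y; μ] + b ^ 2 * Var[Y; μ]) / 2)) := by
  rw [(integral_cos_of_gaussian (hasGaussianLaw_lincomb hXY a b)
    (integral_lincomb hXY hX0 hY0 a b)).1, variance_lincomb hXY]

lemma integral_sin_mul_of_gaussian (hY : HasGaussianLaw Y μ) (hY0 : ∫ ω, Y ω ∂μ = 0) (b : ℝ) :
    ∫ ω, Real.sin (b * Y ω) ∂μ = 0 := by
  refine (integral_cos_of_gaussian (X := fun ω => b * Y ω) ?_ ?_).2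
  · exact hY.map (b • ContinuousLinearMap.id ℝ ℝ)
  · rw [integral_const_mul, hY0, mul_zero]

lemma integral_cos_mul_of_gaussian (hY : HasGaussianLaw Y μ) (hY0 : ∫ ω, Y ω ∂μ = 0) (b : ℝ) :
    ∫ ω, Real.cos (b * Y ω) ∂μ = Real.exp (-(b ^ 2 * Var[Y; μ] / 2)) := by
  rw [(integral_cos_of_gaussian (X := fun ω => b * Y ω) ?_ ?_).1, variance_const_mul]
  · exact hY.map (b • ContinuousLinearMap.id ℝ ℝ)
  · rw [integral_const_mul, hY0, mul_zero]

/-- Differentiate `E cos(tX + bY)` at `t = 0` in two ways: under the integral, with `|X|` as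
dominating function, and in its closed Gaussian form. -/
lemma integral_mul_sin_of_gaussian (hXY : HasGaussianLaw (fun ω => (X ω, Y ω)) μ)
    (hX0 : ∫ ω, X ω ∂μ = 0) (hY0 : ∫ ω, Y ω ∂μ = 0) (b : ℝ) :
    ∫ ω, X ω * Real.sin (b * Y ω) ∂μ
      = cov[X, Y; μ] * b * Real.exp (-(b ^ 2 * Var[Y; μ] / 2)) := by
  have := hXY.isProbabilityMeasure
  have hXm := hXY.fst.aemeasurable
  have hYm := hXY.snd.aemeasurable
  have h1 : HasDerivAt (fun t : ℝ => ∫ ω, Real.cos (t * X ω + b * Y ω) ∂μ)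
      (∫ ω, -Real.sin (0 * X ω + b * Y ω) * X ω ∂μ) 0 := by
    refine (hasDerivAt_integral_of_dominated_loc_of_deriv_le (bound := fun ω => |X ω|)
      (F' := fun t ω => -Real.sin (t * X ω + b * Y ω) * X ω) (Metric.ball_mem_nhds 0 one_pos)
      ?_ ?_ ?_ ?_ ?_ ?_).2
    · exact Eventually.of_forall fun t =>
        (Real.continuous_cos.measurable.comp_aemeasurable (by fun_prop)).aestronglyMeasurable
    · refine Integrable.of_bound (C := 1)
        (Real.continuous_cos.measurable.comp_aemeasurable (by fun_prop)).aestronglyMeasurable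
        (ae_of_all _ fun ω => ?_)
      exact Real.abs_cos_le_one _
    · exact ((Real.continuous_sin.measurable.comp_aemeasurable
        (by fun_prop)).neg.mul hXm).aestronglyMeasurable
    · refine ae_of_all _ fun ω t _ => ?_
      rw [Real.norm_eq_abs, abs_mul, abs_neg]
      exact mul_le_of_le_one_left (abs_nonneg _) (Real.abs_sin_le_one _)
    · exact hXY.fst.integrable.abs
    · refine ae_of_all _ fun ω t _ => ?_
      have h : HasDerivAt (fun t : ℝ => t * X ω + b * Y ω) (X ω) t := by
        simpa using ((hasDerivAt_id t).mul_const (X ω)).add_const (b * Y ω)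
      exact h.cos
  have h2 : HasDerivAt (fun t : ℝ => ∫ ω, Real.cos (t * X ω + b * Y ω) ∂μ)
      (-(cov[X, Y; μ] * b * Real.exp (-(b ^ 2 * Var[Y; μ] / 2)))) 0 := by
    simp_rw [integral_cos_lincomb hXY hX0 hY0]
    have h : HasDerivAt (fun t : ℝ =>
        -((t ^ 2 * Var[X; μ] + 2 * t * b * cov[X, Y; μ] + b ^ 2 * Var[Y; μ]) / 2))
        (-(b * cov[X, Y; μ])) 0 := by
      have ha : HasDerivAt (fun t : ℝ => t ^ 2 * Var[X; μ]) 0 0 := by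
        simpa using ((hasDerivAt_id (0 : ℝ)).pow 2).mul_const (Var[X; μ])
      have hb : HasDerivAt (fun t : ℝ => 2 * t * b * cov[X, Y; μ]) (2 * b * cov[X, Y; μ]) 0 := by
        simpa using (((hasDerivAt_id (0 : ℝ)).const_mul 2).mul_const b).mul_const (cov[X, Y; μ])
      have := (((ha.add hb).add_const (b ^ 2 * Var[Y; μ])).div_const 2).neg
      convert! this using 1
      ring
    have := h.exp
    convert! this using 1
    simp
    ring
  have h3 := h1.unique h2
  simp only [zero_mul, zero_add, neg_mul] at h3
  rw [integral_neg, neg_inj] at h3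
  rw [← h3]
  simp_rw [mul_comm]

lemma integral_sin_mul_sin_of_gaussian (hXY : HasGaussianLaw (fun ω => (X ω, Y ω)) μ)
    (hX0 : ∫ ω, X ω ∂μ = 0) (hY0 : ∫ ω, Y ω ∂μ = 0) (a b : ℝ) :
    ∫ ω, Real.sin (a * X ω) * Real.sin (b * Y ω) ∂μ
      = (Real.exp (-((a ^ 2 * Var[X; μ] - 2 * a * b * cov[X, Y; μ] + b ^ 2 * Var[Y; μ]) / 2))
        - Real.exp (-((a ^ 2 * Var[X; μ] + 2 * a * b * cov[X, Y; μ] + b ^ 2 * Var[Y; μ]) / 2)))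
        / 2 := by
  have := hXY.isProbabilityMeasure
  have hXm := hXY.fst.aemeasurable
  have hYm := hXY.snd.aemeasurable
  have hint : ∀ a b : ℝ, Integrable (fun ω => Real.cos (a * X ω + b * Y ω)) μ := fun a b =>
    Integrable.of_bound (C := 1)
      (Real.continuous_cos.measurable.comp_aemeasurable (by fun_prop)).aestronglyMeasurable
      (ae_of_all _ fun ω => Real.abs_cos_le_one _)
  have h1 := integral_cos_lincomb hXY hX0 hY0 a b
  have h2 := integral_cos_lincomb hXY hX0 hY0 a (-b)
  have h3 : ∀ ω, Real.sin (a * X ω) * Real.sin (b * Y ω)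
      = (Real.cos (a * X ω + -b * Y ω) - Real.cos (a * X ω + b * Y ω)) / 2 := fun ω => by
    rw [neg_mul, ← sub_eq_add_neg, Real.cos_sub, Real.cos_add]; ring
  simp_rw [h3]
  rw [integral_div, integral_sub (hint _ _) (hint _ _), h1, h2]
  ring_nf

/-- Both exponents are half variances of `aX ± bY`, and `a²σ_X² + b²σ_Y² ≥ 2ab σ_X σ_Y` bounds each
from below by `ab(σ_X σ_Y - |cov|)`. A difference of two positive numbers is at most the larger. -/
lemma abs_integral_sin_mul_sin_le (hXY : HasGaussianLaw (fun ω => (X ω, Y ω)) μ)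
    (hX0 : ∫ ω, X ω ∂μ = 0) (hY0 : ∫ ω, Y ω ∂μ = 0) {a b t : ℝ} (ha : 0 ≤ a) (hb : 0 ≤ b)
    (ht : t ≤ a * b * (stdDev μ X * stdDev μ Y - |cov[X, Y; μ]|)) :
    |∫ ω, Real.sin (a * X ω) * Real.sin (b * Y ω) ∂μ| ≤ Real.exp (-t) / 2 := by
  have hvx : stdDev μ X ^ 2 = Var[X; μ] := Real.sq_sqrt (variance_nonneg _ _)
  have hvy : stdDev μ Y ^ 2 = Var[Y; μ] := Real.sq_sqrt (variance_nonneg _ _)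
  rw [integral_sin_mul_sin_of_gaussian hXY hX0 hY0, ← hvx, ← hvy]
  have hab : 0 ≤ a * b := mul_nonneg ha hb
  have hsq := sq_nonneg (a * stdDev μ X - b * stdDev μ Y)
  have hc1 := mul_le_mul_of_nonneg_left (le_abs_self cov[X, Y; μ]) hab
  have hc2 := mul_le_mul_of_nonneg_left (neg_abs_le cov[X, Y; μ]) hab
  rw [abs_div, abs_two]
  refine div_le_div_of_nonneg_right (abs_sub_le_iff.2 ⟨?_, ?_⟩) (by norm_num)
  · refine (sub_le_self _ (Real.exp_pos _).le).trans (Real.exp_le_exp.2 ?_)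
    nlinarith
  · refine (sub_le_self _ (Real.exp_pos _).le).trans (Real.exp_le_exp.2 ?_)
    nlinarith

/-! ### Termwise integration -/

lemma hasSum_integral_mul {ι : Type*} [Countable ι] {g : Ω → ℝ} (hg : Integrable g μ)
    {a : ι → ℝ} (ha : Summable fun i => |a i|) {φ : ι → Ω → ℝ}
    (hφm : ∀ i, AEStronglyMeasurable (φ i) μ) (hφ : ∀ i ω, |φ i ω| ≤ 1) {S : Ω → ℝ}
    (hS : ∀ ω, HasSum (fun i => a i * φ i ω) (S ω)) :
    HasSum (fun i => a i * ∫ ω, g ω * φ i ω ∂μ) (∫ ω, g ω * S ω ∂μ) := by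
  have hgi : ∀ i, Integrable (fun ω => g ω * φ i ω) μ := fun i =>
    hg.mul_bdd (hφm i) (ae_of_all _ (hφ i))
  have h := hasSum_integral_of_summable_integral_norm (μ := μ)
    (F := fun i ω => a i * (g ω * φ i ω)) (fun i => (hgi i).const_mul _) ?_
  · simp_rw [integral_const_mul] at h
    convert! h using 2
    funext ω
    rw [← (hS ω).tsum_eq, ← tsum_mul_left]
    exact tsum_congr fun i => by ring
  · refine Summable.of_nonneg_of_le (fun i => integral_nonneg fun ω => norm_nonneg _) (fun i => ?_)
      (ha.mul_right (∫ ω, |g ω| ∂μ))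
    rw [← integral_const_mul]
    refine integral_mono ((hgi i).const_mul _).norm (hg.abs.const_mul _) fun ω => ?_
    simp only [Real.norm_eq_abs, abs_mul]
    have := hφ i ω
    gcongr
    exact mul_le_of_le_one_right (abs_nonneg _) this

lemma ae_ne_half_odd_of_gaussian (hY : HasGaussianLaw Y μ) (hv : 0 < Var[Y; μ]) (Δ : ℝ) :
    ∀ᵐ ω ∂μ, ∀ n : ℤ, Y ω ≠ Δ * (n + 1 / 2) := by
  rw [ae_all_iff]
  intro n
  have hmap := hY.map_eq_gaussianReal
  have := nullSingletonClass_gaussianReal (μ := ∫ ω, Y ω ∂μ) (v := Var[Y; μ].toNNReal)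
    (by simpa using hv)
  have h : ∀ᵐ y ∂(μ.map Y), y ≠ Δ * (n + 1 / 2) := by
    rw [hmap, ae_iff]
    simp
  exact ae_of_ae_map hY.aemeasurable h

/-! ### Moments of the quantization error of Gaussian variables -/

lemma sq_stdDev (X : Ω → ℝ) : stdDev μ X ^ 2 = Var[X; μ] := Real.sq_sqrt (variance_nonneg _ _)

lemma abs_abelCoeff {Δ r : ℝ} (hΔ : 0 < Δ) (hr0 : 0 ≤ r) (n : ℕ) :
    |abelCoeff Δ r n| = Δ / Real.pi * (r ^ (n + 1) / (n + 1)) := by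
  unfold abelCoeff
  rw [abs_mul, abs_div ((-1) ^ (n + 1) * r ^ (n + 1)), abs_mul, abs_pow (-1), abs_neg, abs_one,
    one_pow, one_mul, abs_of_pos (by positivity : 0 < Δ / Real.pi), abs_of_nonneg (by positivity : 0 ≤ r ^ (n + 1)),
    abs_of_pos (by positivity : (0 : ℝ) < n + 1)]

lemma summable_abs_abelCoeff {Δ r : ℝ} (hΔ : 0 < Δ) (hr0 : 0 ≤ r) (hr1 : r < 1) :
    Summable fun n => |abelCoeff Δ r n| := by
  simp_rw [abs_abelCoeff hΔ hr0]
  refine Summable.mul_left _ ?_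
  refine Summable.of_nonneg_of_le (fun n => by positivity) (fun n => ?_)
    (summable_geometric_of_lt_one hr0 hr1)
  rw [div_le_iff₀ (by positivity), pow_succ]
  have : 0 ≤ r ^ n := by positivity
  exact mul_le_mul_of_nonneg_left (by linarith [n.cast_nonneg (α := ℝ)]) this

lemma tendsto_integral_mul_abelError (hY : HasGaussianLaw Y μ) (hv : 0 < Var[Y; μ])
    {Δ : ℝ} (hΔ : 0 < Δ) {g : Ω → ℝ} (hg : Integrable g μ) :
    Tendsto (fun r => ∫ ω, g ω * abelError Δ r (Y ω) ∂μ) (𝓝[<] 1)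
      (𝓝 (∫ ω, g ω * quantError Δ (Y ω) ∂μ)) := by
  refine tendsto_integral_filter_of_dominated_convergence (fun ω => |g ω| * (Δ / 2)) ?_ ?_ ?_ ?_
  · exact Eventually.of_forall fun r => hg.aestronglyMeasurable.mul
      ((measurable_abelError Δ r).comp_aemeasurable hY.aemeasurable).aestronglyMeasurable
  · filter_upwards [Ioo_mem_nhdsLT (zero_lt_one' ℝ)] with r hr
    refine ae_of_all _ fun ω => ?_
    rw [Real.norm_eq_abs, abs_mul]
    exact mul_le_mul_of_nonneg_left (abs_abelError_le hΔ _ hr.1.le hr.2) (abs_nonneg _)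
  · exact hg.abs.mul_const _
  · filter_upwards [ae_ne_half_odd_of_gaussian hY hv Δ] with ω hω
    exact (tendsto_abelError hΔ hω).const_mul _

lemma sin_aestronglyMeasurable (hY : AEMeasurable Y μ) (b : ℝ) :
    AEStronglyMeasurable (fun ω => Real.sin (b * Y ω)) μ :=
  (Real.continuous_sin.measurable.comp_aemeasurable (hY.const_mul b)).aestronglyMeasurable

lemma sq_harmonic_mul_variance (Y : Ω → ℝ) (Δ t : ℝ) :
    (t * (2 * Real.pi / Δ)) ^ 2 * Var[Y; μ] / 2 = t ^ 2 * sOne (stdDev μ Y) Δ := by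
  unfold sOne
  rw [sq_stdDev]
  ring

lemma integral_quantError_eq_zero (hY : HasGaussianLaw Y μ) (hY0 : ∫ ω, Y ω ∂μ = 0)
    (hv : 0 < Var[Y; μ]) {Δ : ℝ} (hΔ : 0 < Δ) : ∫ ω, quantError Δ (Y ω) ∂μ = 0 := by
  have := hY.isProbabilityMeasure
  have ht := tendsto_integral_mul_abelError hY hv hΔ (integrable_const (1 : ℝ))
  simp only [one_mul] at ht
  refine tendsto_nhds_unique ht (tendsto_const_nhds.congr' ?_)
  filter_upwards [Ioo_mem_nhdsLT (zero_lt_one' ℝ)] with r hr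
  have h := hasSum_integral_mul (integrable_const (1 : ℝ))
    (summable_abs_abelCoeff hΔ hr.1.le hr.2)
    (φ := fun n ω => Real.sin ((n + 1) * (2 * Real.pi / Δ) * Y ω))
    (fun n => sin_aestronglyMeasurable hY.aemeasurable _) (fun n ω => Real.abs_sin_le_one _)
    (fun ω => hasSum_abelError Δ (Y ω) hr.1.le hr.2)
  simp only [one_mul, integral_sin_mul_of_gaussian hY hY0, mul_zero] at h
  exact hasSum_zero.unique h

/-- An alternating series with decreasing weights against Gaussian terms is summable, and its sum
lies between zero and its first term's bound `exp (-s)`. -/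
lemma exists_hasSum_alternating_gaussian {w : ℕ → ℝ} (hw : Antitone w) (hw0 : ∀ n, 0 ≤ w n)
    (hw1 : w 0 ≤ 1) (hws : Summable w) {s : ℝ} (hs : 0 ≤ s) :
    ∃ t ∈ Set.Icc 0 (Real.exp (-s)),
      HasSum (fun n : ℕ => (-1) ^ n * (w n * Real.exp (-(((n : ℝ) + 1) ^ 2 * s)))) t := by
  have hanti : Antitone fun n : ℕ => w n * Real.exp (-(((n : ℝ) + 1) ^ 2 * s)) := by
    intro n l hnl
    have : (n : ℝ) ≤ l := by exact_mod_cast hnl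
    refine mul_le_mul (hw hnl) (Real.exp_le_exp.2 ?_) (Real.exp_pos _).le (hw0 n)
    gcongr
  have hsum : Summable fun n : ℕ => (-1) ^ n * (w n * Real.exp (-(((n : ℝ) + 1) ^ 2 * s))) := by
    refine Summable.of_norm_bounded hws fun n => ?_
    rw [norm_mul, norm_pow, norm_neg, norm_one, one_pow, one_mul, norm_mul, Real.norm_eq_abs,
      Real.norm_eq_abs, abs_of_nonneg (hw0 n), Real.abs_exp]
    refine mul_le_of_le_one_right (hw0 n) (Real.exp_le_one_iff.2 ?_)
    have : 0 ≤ ((n : ℝ) + 1) ^ 2 * s := by positivity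
    linarith
  obtain ⟨h0, h1⟩ := alternating_hasSum_mem hanti hsum.hasSum
  refine ⟨_, ⟨h0, h1.trans ?_⟩, hsum.hasSum⟩
  norm_num
  exact mul_le_of_le_one_left (Real.exp_pos _).le hw1

lemma sOne_nonneg (γ Δ : ℝ) : 0 ≤ sOne γ Δ := by unfold sOne; positivity

lemma integral_mul_quantError (hXY : HasGaussianLaw (fun ω => (X ω, Y ω)) μ)
    (hX0 : ∫ ω, X ω ∂μ = 0) (hY0 : ∫ ω, Y ω ∂μ = 0) (hv : 0 < Var[Y; μ])
    {Δ : ℝ} (hΔ : 0 < Δ) :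
    ∃ t ∈ Set.Icc 0 (Real.exp (-sOne (stdDev μ Y) Δ)),
      ∫ ω, X ω * quantError Δ (Y ω) ∂μ = -2 * cov[X, Y; μ] * t := by
  have := hXY.isProbabilityMeasure
  set s := sOne (stdDev μ Y) Δ with hs
  -- For each `r < 1` the integral already has the required form with some `t` in the interval.
  -- Compactness of the image lets the form pass to the limit without tracking `t` as `r` varies.
  have hclosed : IsClosed ((fun t => -2 * cov[X, Y; μ] * t) '' Set.Icc 0 (Real.exp (-s))) :=
    (isCompact_Icc.image (by fun_prop)).isClosed
  suffices h : ∫ ω, X ω * quantError Δ (Y ω) ∂μ ∈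
      (fun t => -2 * cov[X, Y; μ] * t) '' Set.Icc 0 (Real.exp (-s)) by
    obtain ⟨t, ht, h⟩ := h
    exact ⟨t, ht, h.symm⟩
  refine hclosed.mem_of_tendsto
    (tendsto_integral_mul_abelError hXY.snd hv hΔ hXY.fst.integrable) ?_
  filter_upwards [Ioo_mem_nhdsLT (zero_lt_one' ℝ)] with r hr
  have h := hasSum_integral_mul hXY.fst.integrable
    (summable_abs_abelCoeff hΔ hr.1.le hr.2)
    (φ := fun n ω => Real.sin ((n + 1) * (2 * Real.pi / Δ) * Y ω))
    (fun n => sin_aestronglyMeasurable hXY.snd.aemeasurable _) (fun n ω => Real.abs_sin_le_one _)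
    (fun ω => hasSum_abelError Δ (Y ω) hr.1.le hr.2)
  obtain ⟨t, ht, hsum⟩ := exists_hasSum_alternating_gaussian (w := fun n => r ^ (n + 1))
    (fun n l hnl => pow_le_pow_of_le_one hr.1.le hr.2.le (by omega))
    (fun n => pow_nonneg hr.1.le _) (by simpa using hr.2.le)
    ((summable_geometric_of_lt_one hr.1.le hr.2).comp_injective (add_left_injective 1))
    (sOne_nonneg (stdDev μ Y) Δ)
  refine ⟨t, ht, ?_⟩
  refine (hsum.mul_left (-2 * cov[X, Y; μ])).unique ?_
  convert! h using 2 with n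
  rw [integral_mul_sin_of_gaussian hXY hX0 hY0, sq_harmonic_mul_variance]
  unfold abelCoeff
  have := Real.pi_ne_zero
  field_simp
  ring

/-- In the exponent `-(s + 1)`, one power of each index comes from the Fourier coefficient and `s`
powers from weakening `exp (-(n+1)(l+1)s)`. The bound is free of `r`, so it survives the Abel limit.
-/
lemma norm_crossTerm_le
    (hXY : HasGaussianLaw (fun ω => (X ω, Y ω)) μ)
    (hX0 : ∫ ω, X ω ∂μ = 0) (hY0 : ∫ ω, Y ω ∂μ = 0)
    {Δ₁ Δ₂ s : ℝ} (hΔ₁ : 0 < Δ₁) (hΔ₂ : 0 < Δ₂) (hs : 0 < s)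
    (hsle : s ≤ 4 * Real.pi ^ 2 * (stdDev μ X * stdDev μ Y - |cov[X, Y; μ]|) / (Δ₁ * Δ₂))
    {r : ℝ} (hr0 : 0 ≤ r) (hr1 : r ≤ 1) (n l : ℕ) :
    ‖abelCoeff Δ₁ r n * abelCoeff Δ₂ r l * ∫ ω, Real.sin ((n + 1) * (2 * Real.pi / Δ₁) * X ω)
      * Real.sin ((l + 1) * (2 * Real.pi / Δ₂) * Y ω) ∂μ‖
      ≤ Δ₁ * Δ₂ / (2 * Real.pi ^ 2) * Real.exp (-s)
        * (((n : ℝ) + 1) ^ (-(s + 1)) * ((l : ℝ) + 1) ^ (-(s + 1))) := by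
  have hn : (0 : ℝ) < n + 1 := by positivity
  have hl : (0 : ℝ) < l + 1 := by positivity
  have hnl : (1 : ℝ) ≤ (n + 1) * (l + 1) := by
    nlinarith [n.cast_nonneg (α := ℝ), l.cast_nonneg (α := ℝ)]
  have h1 := abs_integral_sin_mul_sin_le hXY hX0 hY0 (a := (n + 1) * (2 * Real.pi / Δ₁))
    (b := (l + 1) * (2 * Real.pi / Δ₂)) (t := ((n + 1) * (l + 1)) * s) (by positivity)
    (by positivity) (by
      refine (mul_le_mul_of_nonneg_left hsle (by positivity)).trans_eq ?_
      field_simp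
      ring)
  have h2 := exp_neg_mul_le_exp_neg_mul_rpow hnl hs.le
  rw [Real.norm_eq_abs, abs_mul, abs_mul, abs_abelCoeff hΔ₁ hr0, abs_abelCoeff hΔ₂ hr0]
  have hp : ∀ n : ℕ, r ^ (n + 1) ≤ 1 := fun n => pow_le_one₀ hr0 hr1
  calc _ ≤ (Δ₁ / Real.pi * (1 / (n + 1)) * (Δ₂ / Real.pi * (1 / (l + 1))))
        * (Real.exp (-s) * ((n + 1) * (l + 1)) ^ (-s) / 2) := by
        have := hp n
        have := hp l
        have := h1.trans (div_le_div_of_nonneg_right h2 zero_le_two)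
        gcongr
    _ = _ := by
        rw [Real.mul_rpow hn.le hl.le, neg_add, Real.rpow_add hn, Real.rpow_add hl,
          Real.rpow_neg_one, Real.rpow_neg_one]
        field_simp

lemma hasSum_abelError_mul_abelError (Δ₁ Δ₂ x y : ℝ) {r : ℝ} (hr0 : 0 ≤ r) (hr1 : r < 1) :
    HasSum (fun p : ℕ × ℕ => (abelCoeff Δ₁ r p.1 * abelCoeff Δ₂ r p.2)
        * (Real.sin ((p.1 + 1) * (2 * Real.pi / Δ₁) * x)
          * Real.sin ((p.2 + 1) * (2 * Real.pi / Δ₂) * y)))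
      (abelError Δ₁ r x * abelError Δ₂ r y) := by
  have h1 := hasSum_abelError Δ₁ x hr0 hr1
  have h2 := hasSum_abelError Δ₂ y hr0 hr1
  have hs := summable_mul_of_summable_norm h1.summable.norm h2.summable.norm
  have h := h1.mul h2 hs
  refine Eq.subst (motive := fun f => HasSum f _) (funext fun p => ?_) h
  exact mul_mul_mul_comm _ _ _ _

lemma hasSum_integral_abelError_mul_abelError [IsProbabilityMeasure μ]
    (hXm : AEMeasurable X μ) (hYm : AEMeasurable Y μ)
    {Δ₁ Δ₂ r : ℝ} (hΔ₁ : 0 < Δ₁) (hΔ₂ : 0 < Δ₂) (hr0 : 0 ≤ r) (hr1 : r < 1) :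
    HasSum (fun p : ℕ × ℕ => abelCoeff Δ₁ r p.1 * abelCoeff Δ₂ r p.2
        * ∫ ω, Real.sin ((p.1 + 1) * (2 * Real.pi / Δ₁) * X ω)
          * Real.sin ((p.2 + 1) * (2 * Real.pi / Δ₂) * Y ω) ∂μ)
      (∫ ω, abelError Δ₁ r (X ω) * abelError Δ₂ r (Y ω) ∂μ) := by
  have ha : Summable fun p : ℕ × ℕ => |abelCoeff Δ₁ r p.1 * abelCoeff Δ₂ r p.2| := by
    simpa only [abs_mul] using (summable_abs_abelCoeff hΔ₁ hr0 hr1).mul_of_nonneg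
      (summable_abs_abelCoeff hΔ₂ hr0 hr1) (fun _ => abs_nonneg _) (fun _ => abs_nonneg _)
  have hm : ∀ p : ℕ × ℕ, AEStronglyMeasurable (fun ω =>
      Real.sin ((p.1 + 1) * (2 * Real.pi / Δ₁) * X ω)
        * Real.sin ((p.2 + 1) * (2 * Real.pi / Δ₂) * Y ω)) μ := fun p =>
    (sin_aestronglyMeasurable hXm _).mul (sin_aestronglyMeasurable hYm _)
  have hb : ∀ (p : ℕ × ℕ) (ω : Ω), |Real.sin ((p.1 + 1) * (2 * Real.pi / Δ₁) * X ω)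
      * Real.sin ((p.2 + 1) * (2 * Real.pi / Δ₂) * Y ω)| ≤ 1 := fun p ω => by
    rw [abs_mul]
    exact mul_le_one₀ (Real.abs_sin_le_one _) (abs_nonneg _) (Real.abs_sin_le_one _)
  have h := hasSum_integral_mul (integrable_const (1 : ℝ)) ha hm hb
    (fun ω => hasSum_abelError_mul_abelError Δ₁ Δ₂ (X ω) (Y ω) hr0 hr1)
  simpa only [one_mul] using h

lemma abs_integral_quantError_mul_quantError_le
    (hXY : HasGaussianLaw (fun ω => (X ω, Y ω)) μ)
    (hX0 : ∫ ω, X ω ∂μ = 0) (hY0 : ∫ ω, Y ω ∂μ = 0) (hvX : 0 < Var[X; μ]) (hvY : 0 < Var[Y; μ])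
    {Δ₁ Δ₂ s : ℝ} (hΔ₁ : 0 < Δ₁) (hΔ₂ : 0 < Δ₂) (hs : 0 < s)
    (hsle : s ≤ 4 * Real.pi ^ 2 * (stdDev μ X * stdDev μ Y - |cov[X, Y; μ]|) / (Δ₁ * Δ₂)) :
    |∫ ω, quantError Δ₁ (X ω) * quantError Δ₂ (Y ω) ∂μ|
      ≤ Δ₁ * Δ₂ / (2 * Real.pi ^ 2) * Real.exp (-s) * zeta (s + 1) ^ 2 := by
  have := hXY.isProbabilityMeasure
  have hXm := hXY.fst.aemeasurable
  have hYm := hXY.snd.aemeasurable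
  have htend : Tendsto (fun r => ∫ ω, abelError Δ₁ r (X ω) * abelError Δ₂ r (Y ω) ∂μ) (𝓝[<] 1)
      (𝓝 (∫ ω, quantError Δ₁ (X ω) * quantError Δ₂ (Y ω) ∂μ)) := by
    refine tendsto_integral_filter_of_dominated_convergence (fun _ => (Δ₁ / 2) * (Δ₂ / 2))
      ?_ ?_ (integrable_const _) ?_
    · exact Eventually.of_forall fun r =>
        (((measurable_abelError Δ₁ r).comp_aemeasurable hXm).mul
          ((measurable_abelError Δ₂ r).comp_aemeasurable hYm)).aestronglyMeasurable
    · filter_upwards [Ioo_mem_nhdsLT (zero_lt_one' ℝ)] with r hr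
      refine ae_of_all _ fun ω => ?_
      rw [Real.norm_eq_abs, abs_mul]
      exact mul_le_mul (abs_abelError_le hΔ₁ _ hr.1.le hr.2) (abs_abelError_le hΔ₂ _ hr.1.le hr.2)
        (abs_nonneg _) (by positivity)
    · filter_upwards [ae_ne_half_odd_of_gaussian hXY.fst hvX Δ₁,
        ae_ne_half_odd_of_gaussian hXY.snd hvY Δ₂] with ω h1 h2
      exact (tendsto_abelError hΔ₁ h1).mul (tendsto_abelError hΔ₂ h2)
  refine le_of_tendsto htend.abs ?_
  filter_upwards [Ioo_mem_nhdsLT (zero_lt_one' ℝ)] with r hr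
  have h := hasSum_integral_abelError_mul_abelError hXm hYm hΔ₁ hΔ₂ hr.1.le hr.2
  have hz := hasSum_zeta (by linarith : 1 < s + 1)
  have hpos : ∀ n : ℕ, 0 ≤ ((n : ℝ) + 1) ^ (-(s + 1)) := fun n => by positivity
  have hzs : Summable fun p : ℕ × ℕ =>
      ((p.1 : ℝ) + 1) ^ (-(s + 1)) * ((p.2 : ℝ) + 1) ^ (-(s + 1)) :=
    hz.summable.mul_of_nonneg hz.summable hpos hpos
  have hzz := (hz.mul hz hzs).mul_left (Δ₁ * Δ₂ / (2 * Real.pi ^ 2) * Real.exp (-s))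
  rw [← Real.norm_eq_abs, sq (zeta (s + 1))]
  refine h.norm_le_of_bounded hzz fun p => ?_
  exact norm_crossTerm_le hXY hX0 hY0 hΔ₁ hΔ₂ hs hsle hr.1.le hr.2.le p.1 p.2

/-- The alternating series for the deviation from `Δ² / 12`, the mean square of a uniform error,
starts with a negative term and hence has a nonpositive sum. -/
lemma integral_sq_quantError_le (hY : HasGaussianLaw Y μ) (hY0 : ∫ ω, Y ω ∂μ = 0)
    {Δ : ℝ} (hΔ : 0 < Δ) : ∫ ω, quantError Δ (Y ω) ^ 2 ∂μ ≤ Δ ^ 2 / 12 := by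
  have := hY.isProbabilityMeasure
  have hsq : Summable fun n : ℕ => 1 / ((n : ℝ) + 1) ^ 2 := by
    have := (summable_nat_add_iff 1).2 (Real.summable_one_div_nat_pow.2 one_lt_two)
    simpa using this
  have h := hasSum_integral_mul (integrable_const (1 : ℝ))
    (a := fun n : ℕ => Δ ^ 2 / Real.pi ^ 2 * ((-1) ^ (n + 1) / ((n : ℝ) + 1) ^ 2))
    (φ := fun n ω => Real.cos ((n + 1) * (2 * Real.pi / Δ) * Y ω))
    (by
      refine (hsq.mul_left (Δ ^ 2 / Real.pi ^ 2)).congr fun n => ?_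
      rw [abs_mul, abs_div ((-1) ^ (n + 1)), abs_pow (-1), abs_neg, abs_one, one_pow,
        abs_of_nonneg (by positivity : 0 ≤ Δ ^ 2 / Real.pi ^ 2),
        abs_of_nonneg (by positivity : 0 ≤ ((n : ℝ) + 1) ^ 2)])
    (fun n => (Real.continuous_cos.measurable.comp_aemeasurable
      (hY.aemeasurable.const_mul _)).aestronglyMeasurable)
    (fun n ω => Real.abs_cos_le_one _) (fun ω => hasSum_sq_quantError hΔ (Y ω))
  simp only [one_mul, integral_cos_mul_of_gaussian hY hY0, sq_harmonic_mul_variance] at h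
  obtain ⟨t, ht, hsum⟩ := exists_hasSum_alternating_gaussian
    (w := fun n : ℕ => 1 / ((n : ℝ) + 1) ^ 2)
    (fun n l hnl => by
      have : (n : ℝ) ≤ l := by exact_mod_cast hnl
      simp only
      gcongr)
    (fun n => by positivity) (by simp) hsq (sOne_nonneg (stdDev μ Y) Δ)
  have heq := (hsum.mul_left (-(Δ ^ 2 / Real.pi ^ 2))).unique (by
    convert! h using 2 with n
    ring)
  have hqi : Integrable (fun ω => quantError Δ (Y ω) ^ 2) μ := by
    refine Integrable.of_bound (C := (Δ / 2) ^ 2)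
      (((measurable_quantError Δ).comp_aemeasurable hY.aemeasurable).pow_const
        2).aestronglyMeasurable (ae_of_all _ fun ω => ?_)
    rw [norm_pow]
    exact pow_le_pow_left₀ (norm_nonneg _) (abs_quantError_le hΔ _) 2
  rw [integral_sub hqi (integrable_const _)] at heq
  simp only [integral_const, probReal_univ, smul_eq_mul, one_mul] at heq
  have : 0 ≤ Δ ^ 2 / Real.pi ^ 2 * t := mul_nonneg (by positivity) ht.1
  linarith

/-! ### Perturbation of covariances by quantization -/

/-- The function `σ exp(-cσ²)` decreases once `cσ² ≥ 1/2`, which is the hypothesis on `sOne` at `l`.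
This replaces the true deviation by its lower bound. -/
lemma mul_exp_neg_sOne_le {l σ Δ : ℝ} (hl : 0 < l) (hσ : l ≤ σ) (hs : 1 / 2 ≤ sOne l Δ) :
    σ * Real.exp (-sOne σ Δ) ≤ l * Real.exp (-sOne l Δ) := by
  obtain ⟨u, rfl⟩ : ∃ u, σ = l * u := ⟨σ / l, by field_simp⟩
  have hu : 1 ≤ u := by nlinarith
  have hsu : sOne (l * u) Δ = u ^ 2 * sOne l Δ := by unfold sOne; ring
  have hexp : u ≤ Real.exp ((u ^ 2 - 1) * sOne l Δ) := by
    have := Real.add_one_le_exp ((u ^ 2 - 1) * sOne l Δ)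
    nlinarith [sq_nonneg (u - 1)]
  have : Real.exp (-sOne l Δ)
      = Real.exp ((u ^ 2 - 1) * sOne l Δ) * Real.exp (-sOne (l * u) Δ) := by
    rw [← Real.exp_add, hsu]; ring_nf
  rw [this, mul_assoc]
  exact mul_le_mul_of_nonneg_left (mul_le_mul_of_nonneg_right hexp (Real.exp_pos _).le) hl.le

/-- The function `σ² exp(-cσ²)` decreases only once `cσ² ≥ 1`. For values between `1/2` and `1` it
may first increase, and the zeta factor absorbs the gain. -/
lemma sq_mul_exp_neg_sOne_le {l σ Δ : ℝ} (hl : 0 < l) (hσ : l ≤ σ) (hs : 1 / 2 < sOne l Δ) :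
    σ ^ 2 * Real.exp (-sOne σ Δ) ≤ l ^ 2 * (zeta (2 * sOne l Δ) * Real.exp (-sOne l Δ)) := by
  obtain ⟨u, rfl⟩ : ∃ u, σ = l * u := ⟨σ / l, by field_simp⟩
  have hu : 1 ≤ u := by nlinarith
  have hsu : sOne (l * u) Δ = u ^ 2 * sOne l Δ := by unfold sOne; ring
  rw [hsu]
  set s := sOne l Δ with hsdef
  have hz := one_add_two_rpow_le_zeta (by linarith : 1 < 2 * s)
  suffices h : u ^ 2 ≤ zeta (2 * s) * Real.exp ((u ^ 2 - 1) * s) by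
    have he : Real.exp (-s) = Real.exp ((u ^ 2 - 1) * s) * Real.exp (-(u ^ 2 * s)) := by
      rw [← Real.exp_add]; ring_nf
    rw [he, mul_pow, mul_assoc, ← mul_assoc (zeta _)]
    exact mul_le_mul_of_nonneg_left (mul_le_mul_of_nonneg_right h (Real.exp_pos _).le)
      (by positivity)
  have h2 : (0 : ℝ) < (2 : ℝ) ^ (-(2 * s)) := by positivity
  rcases le_total 1 s with h1 | h1
  · have := Real.add_one_le_exp ((u ^ 2 - 1) * s)
    have h3 : u ^ 2 ≤ Real.exp ((u ^ 2 - 1) * s) := by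
      nlinarith [mul_nonneg (by nlinarith : 0 ≤ u ^ 2 - 1) (by linarith : 0 ≤ s - 1)]
    exact h3.trans (le_mul_of_one_le_left (Real.exp_pos _).le (by linarith))
  -- Here `zeta (2s) ≥ 5/4`. Since `v ≤ e^(v-1)` at `v = u²s`, what remains is `s · zeta(2s) ·
  -- e^(1-s) ≥ 1`; the quadratic lower bound for the exponential suffices on `[1/2, 1]`.
  · have h4 : (1 / 4 : ℝ) ≤ (2 : ℝ) ^ (-(2 * s)) := by
      calc (1 / 4 : ℝ) = (2 : ℝ) ^ (-2 : ℝ) := by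
            rw [Real.rpow_neg zero_le_two]; norm_num
        _ ≤ _ := Real.rpow_le_rpow_of_exponent_le one_le_two (by linarith)
    have hq := Real.quadratic_le_exp_of_nonneg (by linarith : 0 ≤ 1 - s)
    have hv := Real.add_one_le_exp (u ^ 2 * s - 1)
    have hmul : Real.exp ((u ^ 2 - 1) * s) = Real.exp (u ^ 2 * s - 1) * Real.exp (1 - s) := by
      rw [← Real.exp_add]; ring_nf
    rw [hmul]
    have hA : u ^ 2 * s ≤ Real.exp (u ^ 2 * s - 1) := by linarith
    have hB : (1 : ℝ) ≤ s * (zeta (2 * s) * Real.exp (1 - s)) := by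
      have h5 : (5 / 4 : ℝ) * (1 + (1 - s) + (1 - s) ^ 2 / 2) ≤ zeta (2 * s) * Real.exp (1 - s) :=
        mul_le_mul (by linarith) hq (by nlinarith) (by linarith)
      have h6 : (1 : ℝ) ≤ s * ((5 / 4 : ℝ) * (1 + (1 - s) + (1 - s) ^ 2 / 2)) := by
        nlinarith [mul_nonneg (by linarith : 0 ≤ s - 1 / 2) (by linarith : 0 ≤ 1 - s),
          mul_nonneg (mul_nonneg (by linarith : 0 ≤ s - 1 / 2) (by linarith : 0 ≤ 1 - s))
            (by linarith : 0 ≤ s)]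
      exact h6.trans (mul_le_mul_of_nonneg_left h5 (by linarith))
    calc u ^ 2 = u ^ 2 * 1 := (mul_one _).symm
      _ ≤ u ^ 2 * (s * (zeta (2 * s) * Real.exp (1 - s))) := by gcongr
      _ = (u ^ 2 * s) * (zeta (2 * s) * Real.exp (1 - s)) := by ring
      _ ≤ Real.exp (u ^ 2 * s - 1) * (zeta (2 * s) * Real.exp (1 - s)) := by
          refine mul_le_mul_of_nonneg_right hA (mul_nonneg (by linarith) (Real.exp_pos _).le)
      _ = _ := by ring

lemma half_lt_sOne {l Δ : ℝ} (hΔ : 0 < Δ) (hlt : Δ < 2 * Real.pi * l) : 1 / 2 < sOne l Δ := by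
  unfold sOne
  rw [lt_div_iff₀ (by positivity)]
  nlinarith

lemma memLp_quantError [IsFiniteMeasure μ] (hY : AEMeasurable Y μ) {Δ : ℝ} (hΔ : 0 < Δ) :
    MemLp (fun ω => quantError Δ (Y ω)) 2 μ :=
  MemLp.of_bound ((measurable_quantError Δ).comp_aemeasurable hY).aestronglyMeasurable (Δ / 2)
    (ae_of_all _ fun ω => abs_quantError_le hΔ (Y ω))

lemma covariance_quantizer_sub (hXY : HasGaussianLaw (fun ω => (X ω, Y ω)) μ)
    (hX0 : ∫ ω, X ω ∂μ = 0) (hY0 : ∫ ω, Y ω ∂μ = 0) (hvX : 0 < Var[X; μ]) (hvY : 0 < Var[Y; μ])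
    {Δ₁ Δ₂ : ℝ} (hΔ₁ : 0 < Δ₁) (hΔ₂ : 0 < Δ₂) :
    cov[fun ω => quantizer Δ₁ (X ω), fun ω => quantizer Δ₂ (Y ω); μ] - cov[X, Y; μ]
      = ∫ ω, X ω * quantError Δ₂ (Y ω) ∂μ + ∫ ω, Y ω * quantError Δ₁ (X ω) ∂μ
        + ∫ ω, quantError Δ₁ (X ω) * quantError Δ₂ (Y ω) ∂μ := by
  have := hXY.isProbabilityMeasure
  have h1 : (fun ω => quantizer Δ₁ (X ω)) = X + fun ω => quantError Δ₁ (X ω) := by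
    funext ω; simp [quantError]
  have h2 : (fun ω => quantizer Δ₂ (Y ω)) = Y + fun ω => quantError Δ₂ (Y ω) := by
    funext ω; simp [quantError]
  have hX := hXY.fst.memLp_two
  have hY := hXY.snd.memLp_two
  have hE := memLp_quantError hXY.fst.aemeasurable hΔ₁
  have hF := memLp_quantError hXY.snd.aemeasurable hΔ₂
  rw [h1, h2, covariance_add_left hX hE (hY.add hF), covariance_add_right hX hY hF,
    covariance_add_right hE hY hF, covariance_eq_sub hX hF, covariance_eq_sub hE hY,
    covariance_eq_sub hE hF, integral_quantError_eq_zero hXY.fst hX0 hvX hΔ₁,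
    integral_quantError_eq_zero hXY.snd hY0 hvY hΔ₂]
  simp only [Pi.mul_apply, mul_zero, sub_zero, zero_mul, mul_comm (quantError Δ₁ _) (Y _)]
  ring

lemma abs_covariance_quantizer_sub_le (hXY : HasGaussianLaw (fun ω => (X ω, Y ω)) μ)
    (hX0 : ∫ ω, X ω ∂μ = 0) (hY0 : ∫ ω, Y ω ∂μ = 0) (hvX : 0 < Var[X; μ]) (hvY : 0 < Var[Y; μ])
    {Δ₁ Δ₂ s : ℝ} (hΔ₁ : 0 < Δ₁) (hΔ₂ : 0 < Δ₂) (hs : 0 < s)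
    (hsle : s ≤ 4 * Real.pi ^ 2 * (stdDev μ X * stdDev μ Y - |cov[X, Y; μ]|) / (Δ₁ * Δ₂)) :
    |cov[fun ω => quantizer Δ₁ (X ω), fun ω => quantizer Δ₂ (Y ω); μ] - cov[X, Y; μ]|
      ≤ 2 * |cov[X, Y; μ]| * Real.exp (-sOne (stdDev μ Y) Δ₂)
        + 2 * |cov[X, Y; μ]| * Real.exp (-sOne (stdDev μ X) Δ₁)
        + Δ₁ * Δ₂ / Real.pi ^ 2 * (zeta (s + 1) ^ 2 * Real.exp (-s)) := by
  rw [covariance_quantizer_sub hXY hX0 hY0 hvX hvY hΔ₁ hΔ₂]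
  have hYX : HasGaussianLaw (fun ω => (Y ω, X ω)) μ :=
    hXY.map ((ContinuousLinearMap.snd ℝ ℝ ℝ).prod (ContinuousLinearMap.fst ℝ ℝ ℝ))
  obtain ⟨t, ht, h1⟩ := integral_mul_quantError hXY hX0 hY0 hvY hΔ₂
  obtain ⟨t', ht', h2⟩ := integral_mul_quantError hYX hY0 hX0 hvX hΔ₁
  have h3 := abs_integral_quantError_mul_quantError_le hXY hX0 hY0 hvX hvY hΔ₁ hΔ₂ hs hsle
  rw [covariance_comm] at h2
  refine (abs_add_three _ _ _).trans (add_le_add (add_le_add ?_ ?_) ?_)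
  · rw [h1, abs_mul, abs_mul, abs_neg, abs_two, abs_of_nonneg ht.1]
    gcongr
    exact ht.2
  · rw [h2, abs_mul, abs_mul, abs_neg, abs_two, abs_of_nonneg ht'.1]
    gcongr
    exact ht'.2
  -- A factor 2 is given away here, to match the coefficient `Δ₁ Δ₂ / π²` hidden in `varrho1` and
  -- `varrho2` (see `four_mul_div_sTwo`).
  · refine h3.trans ?_
    have : 0 ≤ Δ₁ * Δ₂ / Real.pi ^ 2 * (zeta (s + 1) ^ 2 * Real.exp (-s)) := by positivity
    calc _ = Δ₁ * Δ₂ / Real.pi ^ 2 * (zeta (s + 1) ^ 2 * Real.exp (-s)) / 2 := by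
          field_simp
      _ ≤ _ := by linarith

lemma variance_pos_of_stdDev {l : ℝ} (hl : 0 < l) (h : l ≤ stdDev μ X) : 0 < Var[X; μ] := by
  rw [← sq_stdDev]; nlinarith

lemma abs_covariance_le_of_abs_corr_le {ρ : ℝ} (hX : 0 < stdDev μ X) (hY : 0 < stdDev μ Y)
    (h : |corr μ X Y| ≤ ρ) : |cov[X, Y; μ]| ≤ ρ * (stdDev μ X * stdDev μ Y) := by
  unfold corr at h
  rwa [abs_div, abs_of_pos (mul_pos hX hY), div_le_iff₀ (mul_pos hX hY)] at h

lemma sTwo_pos {l₁ l₂ ρ Δ₁ Δ₂ : ℝ} (hl₁ : 0 < l₁) (hl₂ : 0 < l₂) (hρ : ρ < 1) (hΔ₁ : 0 < Δ₁)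
    (hΔ₂ : 0 < Δ₂) : 0 < sTwo l₁ l₂ ρ Δ₁ Δ₂ := by
  have : 0 < 1 - ρ := by linarith
  unfold sTwo
  positivity

lemma sTwo_le {l₁ l₂ ρ Δ₁ Δ₂ σ₁ σ₂ c : ℝ} (hl₁ : 0 < l₁) (hl₂ : 0 < l₂) (hρ : ρ < 1)
    (hΔ₁ : 0 < Δ₁) (hΔ₂ : 0 < Δ₂) (h₁ : l₁ ≤ σ₁) (h₂ : l₂ ≤ σ₂) (hc : c ≤ ρ * (σ₁ * σ₂)) :
    sTwo l₁ l₂ ρ Δ₁ Δ₂ ≤ 4 * Real.pi ^ 2 * (σ₁ * σ₂ - c) / (Δ₁ * Δ₂) := by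
  unfold sTwo
  have h : l₁ * l₂ ≤ σ₁ * σ₂ := mul_le_mul h₁ h₂ hl₂.le (by linarith)
  have : l₁ * l₂ * (1 - ρ) ≤ σ₁ * σ₂ - c := by nlinarith
  rw [show 4 * Real.pi ^ 2 * l₁ * l₂ * (1 - ρ) = 4 * Real.pi ^ 2 * (l₁ * l₂ * (1 - ρ)) by ring]
  gcongr

lemma four_mul_div_sTwo {l₁ l₂ ρ Δ₁ Δ₂ : ℝ} (hl₁ : 0 < l₁) (hl₂ : 0 < l₂) (hρ : ρ < 1)
    (hΔ₁ : 0 < Δ₁) (hΔ₂ : 0 < Δ₂) (y z : ℝ) :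
    4 * (l₁ * l₂) * (1 - ρ) * (z / (sTwo l₁ l₂ ρ Δ₁ Δ₂ * Real.exp y))
      = Δ₁ * Δ₂ / Real.pi ^ 2 * (z * Real.exp (-y)) := by
  have : 1 - ρ ≠ 0 := by linarith
  have := Real.pi_ne_zero
  unfold sTwo
  rw [Real.exp_neg]
  field_simp

/-- Equal deviations turn the single-error terms into `ρσ² exp(-sOne σ Δ)`, which is controlled by
the lower bound `l` alone. -/
theorem abs_covariance_quantizer_sub_le_varrho1 (hXY : HasGaussianLaw (fun ω => (X ω, Y ω)) μ)
    (hX0 : ∫ ω, X ω ∂μ = 0) (hY0 : ∫ ω, Y ω ∂μ = 0) {l ρ Δ : ℝ} (hl : 0 < l)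
    (hX : l ≤ stdDev μ X) (hsd : stdDev μ Y = stdDev μ X) (hρ : |corr μ X Y| ≤ ρ) (hρ1 : ρ < 1)
    (hΔ : 0 < Δ) (hΔlt : Δ < 2 * Real.pi * l) :
    |cov[fun ω => quantizer Δ (X ω), fun ω => quantizer Δ (Y ω); μ] - cov[X, Y; μ]|
      ≤ varrho1 l ρ Δ := by
  have hρ0 : 0 ≤ ρ := (abs_nonneg _).trans hρ
  have hc := abs_covariance_le_of_abs_corr_le (by linarith) (by linarith) hρ
  have h := abs_covariance_quantizer_sub_le hXY hX0 hY0 (variance_pos_of_stdDev hl hX)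
    (variance_pos_of_stdDev hl (hX.trans_eq hsd.symm)) hΔ hΔ (sTwo_pos hl hl hρ1 hΔ hΔ)
    (sTwo_le hl hl hρ1 hΔ hΔ hX (hX.trans_eq hsd.symm) hc)
  refine h.trans ?_
  rw [hsd] at hc ⊢
  rw [varrho1, show 4 * l ^ 2 * (1 - ρ) = 4 * (l * l) * (1 - ρ) by ring,
    four_mul_div_sTwo hl hl hρ1 hΔ hΔ, add_comm]
  refine add_le_add le_rfl ?_
  have hs := sq_mul_exp_neg_sOne_le hl hX (half_lt_sOne hΔ hΔlt)
  calc _ = 4 * (|cov[X, Y; μ]| * Real.exp (-sOne (stdDev μ X) Δ)) := by ring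
    _ ≤ 4 * (ρ * (stdDev μ X * stdDev μ X) * Real.exp (-sOne (stdDev μ X) Δ)) := by gcongr
    _ = 4 * ρ * (stdDev μ X ^ 2 * Real.exp (-sOne (stdDev μ X) Δ)) := by ring
    _ ≤ 4 * ρ * (l ^ 2 * (zeta (2 * sOne l Δ) * Real.exp (-sOne l Δ))) := by gcongr
    _ = _ := by rw [Real.exp_neg]; ring

theorem abs_covariance_quantizer_sub_le_varrho2 (hXY : HasGaussianLaw (fun ω => (X ω, Y ω)) μ)
    (hX0 : ∫ ω, X ω ∂μ = 0) (hY0 : ∫ ω, Y ω ∂μ = 0) {lx ux lz uz ρ Δx Δz : ℝ} (hlx : 0 < lx)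
    (hlz : 0 < lz) (hX : lx ≤ stdDev μ X ∧ stdDev μ X ≤ ux)
    (hY : lz ≤ stdDev μ Y ∧ stdDev μ Y ≤ uz) (hρ : |corr μ X Y| ≤ ρ) (hρ1 : ρ < 1)
    (hΔx : 0 < Δx) (hΔz : 0 < Δz) (hΔx_lt : Δx < 2 * Real.pi * lx)
    (hΔz_lt : Δz < 2 * Real.pi * lz) :
    |cov[fun ω => quantizer Δx (X ω), fun ω => quantizer Δz (Y ω); μ] - cov[X, Y; μ]|
      ≤ varrho2 lx ux lz uz ρ Δx Δz := by
  have hρ0 : 0 ≤ ρ := (abs_nonneg _).trans hρ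
  have hσX : 0 < stdDev μ X := by linarith [hX.1]
  have hσY : 0 < stdDev μ Y := by linarith [hY.1]
  have hc := abs_covariance_le_of_abs_corr_le hσX hσY hρ
  have h := abs_covariance_quantizer_sub_le hXY hX0 hY0 (variance_pos_of_stdDev hlx hX.1)
    (variance_pos_of_stdDev hlz hY.1) hΔx hΔz (sTwo_pos hlx hlz hρ1 hΔx hΔz)
    (sTwo_le hlx hlz hρ1 hΔx hΔz hX.1 hY.1 hc)
  refine h.trans ?_
  have key : ∀ {l σ Δ : ℝ}, 0 < l → l ≤ σ → 0 < Δ → Δ < 2 * Real.pi * l →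
      σ * Real.exp (-sOne σ Δ) ≤ l * (zeta (2 * sOne l Δ) / Real.exp (sOne l Δ)) := by
    intro l σ Δ hl hσ hΔ hΔlt
    have hs := half_lt_sOne hΔ hΔlt
    refine (mul_exp_neg_sOne_le hl hσ hs.le).trans (mul_le_mul_of_nonneg_left ?_ hl.le)
    rw [Real.exp_neg, div_eq_mul_inv]
    exact le_mul_of_one_le_left (by positivity) (one_le_zeta (by linarith))
  have kx := key hlx hX.1 hΔx hΔx_lt
  have kz := key hlz hY.1 hΔz hΔz_lt
  have pos : ∀ {l σ Δ : ℝ}, 0 < σ → 0 ≤ σ * Real.exp (-sOne σ Δ) := fun h => by positivity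
  rw [varrho2, mul_add 2, ← mul_assoc 2 ρ]
  refine add_le_add ?_ (le_of_eq ?_)
  · calc _ = 2 * |cov[X, Y; μ]| * (Real.exp (-sOne (stdDev μ Y) Δz)
          + Real.exp (-sOne (stdDev μ X) Δx)) := by ring
      _ ≤ 2 * (ρ * (stdDev μ X * stdDev μ Y)) * (Real.exp (-sOne (stdDev μ Y) Δz)
          + Real.exp (-sOne (stdDev μ X) Δx)) := by gcongr
      _ = 2 * ρ * (stdDev μ X * (stdDev μ Y * Real.exp (-sOne (stdDev μ Y) Δz))
          + stdDev μ Y * (stdDev μ X * Real.exp (-sOne (stdDev μ X) Δx))) := by ring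
      -- In each product the deviation matching the exponential is moved down to its lower bound,
      -- and the other up to its upper bound.
      _ ≤ 2 * ρ * (ux * (lz * (zeta (2 * sOne lz Δz) / Real.exp (sOne lz Δz)))
          + uz * (lx * (zeta (2 * sOne lx Δx) / Real.exp (sOne lx Δx)))) := by
          refine mul_le_mul_of_nonneg_left (add_le_add ?_ ?_) (by positivity)
          · exact mul_le_mul hX.2 kz (by positivity) (hσX.le.trans hX.2)
          · exact mul_le_mul hY.2 kx (by positivity) (hσY.le.trans hY.2)
      _ = _ := by ring
  · rw [← four_mul_div_sTwo hlx hlz hρ1 hΔx hΔz]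
    ring

/-- The change of variance is `-4 Var[Y] t + E[e²]` with `e` the error. Both parts are at most `Δ² /
12` in size and have opposite signs, so the first term of `varrho3` suffices and the others are
nonnegative slack. -/
theorem abs_variance_quantizer_sub_le_varrho3 (hY : HasGaussianLaw Y μ)
    (hY0 : ∫ ω, Y ω ∂μ = 0) {l u Δ : ℝ} (hl : 0 < l)
    (hl_le : l ≤ stdDev μ Y) (hΔ : 0 < Δ) (hΔlt : Δ < 2 * Real.pi * l) :
    |cov[fun ω => quantizer Δ (Y ω), fun ω => quantizer Δ (Y ω); μ] - cov[Y, Y; μ]|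
      ≤ varrho3 l u Δ := by
  have hYY : HasGaussianLaw (fun ω => (Y ω, Y ω)) μ :=
    hY.map ((ContinuousLinearMap.id ℝ ℝ).prod (ContinuousLinearMap.id ℝ ℝ))
  have hv := variance_pos_of_stdDev hl hl_le
  rw [covariance_quantizer_sub hYY hY0 hY0 hv hv hΔ hΔ]
  obtain ⟨t, ht, h1⟩ := integral_mul_quantError hYY hY0 hY0 hv hΔ
  have h2 := integral_sq_quantError_le hY hY0 hΔ
  have h3 : 0 ≤ ∫ ω, quantError Δ (Y ω) ^ 2 ∂μ := integral_nonneg fun ω => sq_nonneg _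
  rw [h1, covariance_self hY.aemeasurable]
  simp_rw [← sq]
  have hs := half_lt_sOne hΔ hΔlt
  have hz1 := one_le_zeta (by linarith : 1 < 2 * sOne l Δ)
  have hz2 := one_le_zeta (by linarith : 1 < 2 * sOne l Δ + 2)
  have hlow : Δ ^ 2 / 12 ≤ varrho3 l u Δ := by
    unfold varrho3
    have a1 : 0 ≤ Δ ^ 2 / (Real.pi ^ 2 * Real.exp (sOne l Δ)) * zeta (2 * sOne l Δ + 2) :=
      mul_nonneg (by positivity) (by linarith)
    have a2 : 0 ≤ 4 * u ^ 2 / ((2 : ℝ) ^ (sOne l Δ) * Real.exp (sOne l Δ))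
        * zeta (2 * sOne l Δ) := mul_nonneg (by positivity) (by linarith)
    linarith
  have hvt : 0 ≤ Var[Y; μ] * t := mul_nonneg hv.le ht.1
  have hsv : Var[Y; μ] * (2 * Real.pi ^ 2) = sOne (stdDev μ Y) Δ * Δ ^ 2 := by
    unfold sOne; rw [sq_stdDev]; field_simp
  -- As `Var[Y] = sΔ²/(2π²)` and `st ≤ s e^(-s) ≤ 1/e`, the left side is at most `2Δ²/(π²e)`. With
  -- `π² ≥ 9` the claim needs `e ≥ 8/3`, hence the numerical bound on `e`.
  have hmain : 4 * (Var[Y; μ] * t) ≤ Δ ^ 2 / 12 := by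
    set s := sOne (stdDev μ Y) Δ
    have hse : s * Real.exp (-s) ≤ Real.exp (-1) := by
      have := Real.add_one_le_exp (s - 1)
      calc s * Real.exp (-s) ≤ Real.exp (s - 1) * Real.exp (-s) := by gcongr; linarith
        _ = Real.exp (-1) := by rw [← Real.exp_add]; ring_nf
    have he : Real.exp (-1) * 2.7182818283 ≤ 1 := by
      have := Real.exp_one_gt_d9
      rw [Real.exp_neg, inv_mul_le_iff₀ (Real.exp_pos _)]
      linarith
    have hst : s * t ≤ Real.exp (-1) :=
      (mul_le_mul_of_nonneg_left ht.2 (sOne_nonneg _ _)).trans hse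
    have hpi : 9 ≤ Real.pi ^ 2 := by nlinarith [Real.pi_gt_three]
    have h9 : (Var[Y; μ] * t) * 18 ≤ Δ ^ 2 * Real.exp (-1) := by
      calc (Var[Y; μ] * t) * 18 ≤ (Var[Y; μ] * t) * (2 * Real.pi ^ 2) := by gcongr; linarith
        _ = Δ ^ 2 * (s * t) := by linear_combination t * hsv
        _ ≤ _ := by gcongr
    nlinarith [sq_nonneg Δ, Real.exp_pos (-1)]
  rw [abs_le]
  constructor <;> linarith

/-! ### The smallest singular value -/

/-- If the last singular value is positive, the normalized images `T v_i / σ_i` of the first `d + 1`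
right singular vectors form an orthonormal basis of `F`. Parseval in `F` and in `E` then compares
the norms through `⟪v_i, T* u⟫ = σ_i ⟪w_i, u⟫`. -/
lemma singularValues_mul_norm_le_norm_adjoint {E F : Type*} [NormedAddCommGroup E]
    [InnerProductSpace ℝ E] [FiniteDimensional ℝ E] [NormedAddCommGroup F] [InnerProductSpace ℝ F]
    [FiniteDimensional ℝ F] (T : E →ₗ[ℝ] F) {d : ℕ} (hd : finrank ℝ F = d + 1)
    (hle : d + 1 ≤ finrank ℝ E) (u : F) :
    T.singularValues d * ‖u‖ ≤ ‖T.adjoint u‖ := by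
  rcases (T.singularValues_nonneg d).eq_or_lt with h0 | hpos
  · rw [← h0, zero_mul]; exact norm_nonneg _
  set n := finrank ℝ E with hn
  have hS := T.isSymmetric_adjoint_comp_self
  set v := hS.eigenvectorBasis rfl with hv
  set e : Fin (d + 1) → Fin n := Fin.castLE hle with he
  have hinj : Function.Injective e := Fin.castLE_injective hle
  have hlam : ∀ i, T.singularValues d ≤ T.singularValues (e i) := fun i =>
    T.singularValues_antitone (by simp only [he, Fin.val_castLE]; omega)
  have hlam0 : ∀ i, 0 < T.singularValues (e i) := fun i => hpos.trans_le (hlam i)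
  have hTT : ∀ i j, inner ℝ (T (v i)) (T (v j))
      = if i = j then T.singularValues j ^ 2 else 0 := by
    intro i j
    rw [← LinearMap.adjoint_inner_right, ← LinearMap.comp_apply, hv, hS.apply_eigenvectorBasis rfl j,
      inner_smul_right, ← T.sq_singularValues_fin rfl j,
      orthonormal_iff_ite.1 (hS.eigenvectorBasis rfl).orthonormal]
    simp
  set w : Fin (d + 1) → F := fun i => (T.singularValues (e i))⁻¹ • T (v (e i)) with hw
  have hwon : Orthonormal ℝ w := by
    rw [orthonormal_iff_ite]
    intro i j
    simp only [hw, inner_smul_left, inner_smul_right, hTT, hinj.eq_iff]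
    split_ifs with hij
    · subst hij
      have := (hlam0 i).ne'
      simp
      field_simp
    · simp
  have hspan : Submodule.span ℝ (Set.range w) = ⊤ :=
    hwon.linearIndependent.span_eq_top_of_card_eq_finrank' (by rw [hd, Fintype.card_fin])
  set b := OrthonormalBasis.mk hwon hspan.ge with hb
  have hbw : ∀ i, b i = w i := fun i => by simp [hb]
  have h1 : ∑ i, inner ℝ (w i) u ^ 2 = ‖u‖ ^ 2 := by
    rw [← b.sum_sq_norm_inner_right u]
    exact Finset.sum_congr rfl fun i _ => by rw [hbw, Real.norm_eq_abs, sq_abs]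
  have h2 : ∑ i, inner ℝ (v i) (T.adjoint u) ^ 2 = ‖T.adjoint u‖ ^ 2 := by
    rw [← v.sum_sq_norm_inner_right]
    exact Finset.sum_congr rfl fun i _ => by rw [Real.norm_eq_abs, sq_abs]
  refine le_of_sq_le_sq ?_ (norm_nonneg _)
  rw [mul_pow, ← h1, ← h2, Finset.mul_sum]
  calc ∑ i, T.singularValues d ^ 2 * inner ℝ (w i) u ^ 2
      ≤ ∑ i, inner ℝ (v (e i)) (T.adjoint u) ^ 2 := by
        refine Finset.sum_le_sum fun i _ => ?_
        have h3 : inner ℝ (v (e i)) (T.adjoint u)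
            = T.singularValues (e i) * inner ℝ (w i) u := by
          rw [LinearMap.adjoint_inner_right, hw, inner_smul_left]
          have := (hlam0 i).ne'
          simp
          field_simp
        rw [h3, mul_pow]
        have := hlam i
        gcongr
    _ = ∑ k ∈ Finset.univ.map ⟨e, hinj⟩, inner ℝ (v k) (T.adjoint u) ^ 2 := by
        rw [Finset.sum_map]; rfl
    _ ≤ _ := Finset.sum_le_sum_of_subset_of_nonneg (Finset.subset_univ _)
        fun _ _ _ => sq_nonneg _

lemma sq_sigmaMin_mul_le {r c : Type*} [Fintype r] [Fintype c] [DecidableEq r] [DecidableEq c]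
    [Nonempty r] (M : Matrix r c ℝ) (hrc : Fintype.card r ≤ Fintype.card c) (u : r → ℝ) :
    sigmaMin M ^ 2 * ∑ i, u i ^ 2 ≤ ∑ j, (∑ i, u i * M i j) ^ 2 := by
  have hr : 0 < Fintype.card r := Fintype.card_pos
  have h := singularValues_mul_norm_le_norm_adjoint (Matrix.toEuclideanLin M)
    (d := Fintype.card r - 1) (by rw [finrank_euclideanSpace]; omega)
    (by rw [finrank_euclideanSpace]; omega) (WithLp.toLp 2 u)
  rw [← Matrix.toEuclideanLin_conjTranspose_eq_adjoint] at h
  have h2 := pow_le_pow_left₀ (mul_nonneg (LinearMap.singularValues_nonneg _ _) (norm_nonneg _)) h 2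
  rw [mul_pow, EuclideanSpace.real_norm_sq_eq, EuclideanSpace.real_norm_sq_eq] at h2
  rw [sigmaMin, min_eq_left hrc]
  convert! h2 using 3 with j
  simp [Matrix.mulVec, dotProduct, mul_comm]

/-- Schur's test. -/
lemma sum_sq_sum_mul_le {r c : Type*} [Fintype r] [Fintype c] (M : Matrix r c ℝ) {A B : ℝ}
    (hA : ∀ i, ∑ j, |M i j| ≤ A) (hB : ∀ j, ∑ i, |M i j| ≤ B) (hB0 : 0 ≤ B) (u : r → ℝ) :
    ∑ j, (∑ i, u i * M i j) ^ 2 ≤ A * B * ∑ i, u i ^ 2 := by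
  calc ∑ j, (∑ i, u i * M i j) ^ 2 ≤ ∑ j, B * ∑ i, |M i j| * u i ^ 2 := by
        refine Finset.sum_le_sum fun j _ => ?_
        refine (Finset.sum_sq_le_sum_mul_sum_of_sq_le_mul Finset.univ
          (f := fun i => |M i j|) (g := fun i => |M i j| * u i ^ 2)
          (fun i _ => abs_nonneg _) (fun i _ => by positivity) (fun i _ => ?_)).trans ?_
        · rw [mul_pow, ← sq_abs (M i j)]; exact le_of_eq (by ring)
        · exact mul_le_mul_of_nonneg_right (hB j) (Finset.sum_nonneg fun i _ => by positivity)
    _ = B * ∑ i, (∑ j, |M i j|) * u i ^ 2 := by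
        rw [← Finset.mul_sum, Finset.sum_comm]
        simp_rw [Finset.sum_mul]
    _ ≤ B * ∑ i, A * u i ^ 2 := by
        gcongr with i
        exact hA i
    _ = _ := by rw [← Finset.mul_sum]; ring

theorem sigmaMin_le_of_left_null {r c : Type*} [Fintype r] [Fintype c] [DecidableEq r]
    [DecidableEq c] [Nonempty r] [Nonempty c] (M C : Matrix r c ℝ)
    (hrc : Fintype.card r ≤ Fintype.card c)
    {A B : ℝ} (hA : ∀ i, ∑ j, |M i j - C i j| ≤ A) (hB : ∀ j, ∑ i, |M i j - C i j| ≤ B)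
    {u : r → ℝ} (hu : u ≠ 0) (hC : ∀ j, ∑ i, u i * C i j = 0) : sigmaMin M ≤ √(A * B) := by
  have hB0 : 0 ≤ B := (Finset.sum_nonneg fun i _ => abs_nonneg _).trans
    (hB (Classical.arbitrary c))
  have h1 := sq_sigmaMin_mul_le M hrc u
  have h2 := sum_sq_sum_mul_le (M - C) hA hB hB0 u
  have h3 : ∀ j, ∑ i, u i * (M - C) i j = ∑ i, u i * M i j := fun j => by
    simp [mul_sub, hC]
  simp_rw [h3] at h2
  have hpos : 0 < ∑ i, u i ^ 2 := by
    obtain ⟨i, hi⟩ := Function.ne_iff.1 hu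
    exact Finset.sum_pos' (fun i _ => sq_nonneg _) ⟨i, Finset.mem_univ _, by
      have : u i ≠ 0 := hi
      positivity⟩
  exact Real.le_sqrt_of_sq_le (le_of_mul_le_mul_right (h1.trans h2) hpos)

/-! ### Gaussian regression -/

lemma covariance_sum_mul_left [IsFiniteMeasure μ] {ι : Type*} [Fintype ι] {W : ι → Ω → ℝ}
    {Z : Ω → ℝ} (hW : ∀ i, MemLp (W i) 2 μ) (hZ : MemLp Z 2 μ) (a : ι → ℝ) :
    cov[fun ω => ∑ i, a i * W i ω, Z; μ] = ∑ i, a i * cov[W i, Z; μ] := by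
  rw [covariance_fun_sum_left (fun i => (hW i).const_mul (a i)) hZ]
  simp_rw [covariance_const_mul_left]

/-- The normal equations of linear regression are solvable when the regressors satisfy no
deterministic affine relation. -/
lemma exists_regression [IsProbabilityMeasure μ] {ι : Type*} [Fintype ι] [DecidableEq ι]
    {W : ι → Ω → ℝ} (hW : ∀ i, MemLp (W i) 2 μ) (Z : Ω → ℝ)
    (hnd : ∀ (a : ι → ℝ) (c : ℝ), (∀ᵐ ω ∂μ, ∑ i, a i * W i ω = c) → a = 0) :
    ∃ a : ι → ℝ, ∀ j, cov[Z, W j; μ] = ∑ i, a i * cov[W i, W j; μ] := by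
  set G : Matrix ι ι ℝ := Matrix.of fun i j => cov[W i, W j; μ] with hG
  -- A null vector of the Gram matrix gives a combination of zero variance, hence almost surely
  -- constant. Injectivity of a square system gives solvability.
  have hinj : Function.Injective G.vecMulLinear := by
    rw [injective_iff_map_eq_zero]
    intro a ha
    have ha' : ∀ j, ∑ i, a i * cov[W i, W j; μ] = 0 := fun j => congrFun ha j
    have hmem : MemLp (fun ω => ∑ i, a i * W i ω) 2 μ :=
      memLp_finsetSum _ fun i _ => (hW i).const_mul (a i)
    have hvar : Var[fun ω => ∑ i, a i * W i ω; μ] = 0 := by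
      rw [← covariance_self hmem.aestronglyMeasurable.aemeasurable,
        covariance_sum_mul_left hW hmem]
      refine Finset.sum_eq_zero fun i _ => ?_
      rw [covariance_comm, covariance_sum_mul_left hW (hW i), ha' i, mul_zero]
    have hae := ae_eq_integral_of_variance_eq_zero hmem hvar
    exact hnd a _ hae
  obtain ⟨a, ha⟩ := (LinearMap.injective_iff_surjective.1 hinj) fun j => cov[Z, W j; μ]
  exact ⟨a, fun j => (congrFun ha j).symm⟩

/-- The residual is uncorrelated with the regressors and jointly Gaussian with them, so it is
independent of them and its conditional mean is its mean, zero. The maps `φ` and `ψ` express that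
`U` and the regressors carry the same information in different packaging. -/
lemma condExp_eq_regression {T ι S : Type*} [Fintype ι] [MeasurableSpace S] {P : T → Ω → ℝ}
    (hP : IsGaussianProcess P μ) (hP0 : ∀ t, ∫ ω, P t ω ∂μ = 0) (t₀ : T) (f : ι → T)
    {U : Ω → S} (hU : Measurable U) {φ : (ι → ℝ) → S} (hφ : Measurable φ)
    (hUφ : U = fun ω => φ fun i => P (f i) ω) {ψ : ι → S → ℝ} (hψ : ∀ i, Measurable (ψ i))
    (hψU : ∀ i, P (f i) = ψ i ∘ U) (ht₀ : Measurable (P t₀)) {a : ι → ℝ}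
    (ha : ∀ j, cov[P t₀, P (f j); μ] = ∑ i, a i * cov[P (f i), P (f j); μ]) :
    μ[P t₀ | MeasurableSpace.comap U inferInstance] =ᵐ[μ] fun ω => ∑ i, a i * P (f i) ω := by
  classical
  have := hP.isProbabilityMeasure
  have hm : ∀ i, Measurable (P (f i)) := fun i => by rw [hψU]; exact (hψ i).comp hU
  have hL2 : ∀ t, MemLp (P t) 2 μ := fun t => (hP.hasGaussianLaw_eval t).memLp_two
  have hint : ∀ t, Integrable (P t) μ := fun t => (hP.hasGaussianLaw_eval t).integrable
  set F : Ω → ℝ := fun ω => ∑ i, a i * P (f i) ω with hF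
  have hFm : Measurable F := by fun_prop
  have hFint : Integrable F μ := integrable_finsetSum _ fun i _ => (hint _).const_mul _
  have hFL2 : MemLp F 2 μ := memLp_finsetSum _ fun i _ => (hL2 _).const_mul _
  set R : Ω → ℝ := P t₀ - F with hR
  have hRm : Measurable R := ht₀.sub hFm
  have hgp : IsGaussianProcess (Sum.elim (fun _ : Unit => R) fun i => P (f i)) μ := by
    refine hP.of_isGaussianProcess fun s => ?_
    have hmem : ∀ i, f i ∈ insert t₀ (Finset.univ.image f) := fun i => by simp
    refine ⟨insert t₀ (Finset.univ.image f), ?_⟩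
    rcases s with _ | i
    · refine ⟨ContinuousLinearMap.proj ⟨t₀, by simp⟩
        - ∑ i, a i • ContinuousLinearMap.proj ⟨f i, hmem i⟩, fun ω => ?_⟩
      simp [hR, hF]
    · exact ⟨ContinuousLinearMap.proj ⟨f i, hmem i⟩, fun ω => by simp⟩
  have hind := hgp.indepFun_of_covariance_eq_zero (fun _ => hRm.aemeasurable)
    (fun i => (hm i).aemeasurable) (fun _ j => by
      rw [hR, covariance_sub_left (hL2 _) hFL2 (hL2 _), hF,
        covariance_sum_mul_left (fun i => hL2 (f i)) (hL2 _), ha j, sub_self])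
  have hind' : IndepFun R U μ := by
    have := hind.comp (measurable_pi_apply ()) hφ
    rw [hUφ]
    exact this
  have hR0 : ∫ ω, R ω ∂μ = 0 := by
    have : ∫ ω, R ω ∂μ = ∫ ω, P t₀ ω ∂μ - ∫ ω, F ω ∂μ := integral_sub (hint _) hFint
    rw [this, hP0, hF, integral_finsetSum _ fun i _ => (hint _).const_mul _]
    simp [integral_const_mul, hP0]
  have hcR : μ[R | MeasurableSpace.comap U inferInstance] =ᵐ[μ] fun _ => 0 := by
    have := condExp_indep_eq hRm.comap_le hU.comap_le
      (comap_measurable R).stronglyMeasurable hind'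
    rwa [hR0] at this
  have hFU : StronglyMeasurable[MeasurableSpace.comap U inferInstance] F := by
    refine Measurable.stronglyMeasurable ?_
    rw [hF]
    refine Finset.measurable_sum _ fun i _ => Measurable.const_mul ?_ _
    rw [hψU]
    exact (hψ i).comp (comap_measurable U)
  have hsum : P t₀ = R + F := by simp [hR]
  have hadd := condExp_add ((hint t₀).sub hFint) hFint (MeasurableSpace.comap U inferInstance)
  rw [condExp_of_stronglyMeasurable hU.comap_le hFU hFint] at hadd
  rw [hsum]
  filter_upwards [hadd, hcR] with ω h1 h2
  rw [h1, Pi.add_apply]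
  exact (congrArg (· + F ω) h2).trans (zero_add _)

lemma condExp_eq_of_condLawEq [IsFiniteMeasure μ] {S T : Type*} [MeasurableSpace S]
    [MeasurableSpace T] {Y : Ω → ℝ} {U : Ω → S} {V : Ω → T} (hU : Measurable U)
    (hV : Measurable V) (hY : Integrable Y μ) (h : CondLawEq μ Y U V) :
    μ[Y | MeasurableSpace.comap U inferInstance]
      =ᵐ[μ] μ[Y | MeasurableSpace.comap V inferInstance] := by
  filter_upwards [condExp_ae_eq_integral_condDistrib' hU hY,
    condExp_ae_eq_integral_condDistrib' hV hY, h] with ω h1 h2 h3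
  rw [h1, h2, h3]

/-! ### Absence of Granger causality -/

/-- The two coordinate processes as one scalar process. -/
def scalarProcess (x z : ℕ → Ω → ℝ) : ℕ ⊕ ℕ → Ω → ℝ :=
  Sum.elim (fun n => x (n + 1)) fun n => z (n + 1)

lemma isGaussianProcess_scalarProcess {x z : ℕ → Ω → ℝ}
    (h : IsGaussianProcess (pairProcess x z) μ) : IsGaussianProcess (scalarProcess x z) μ := by
  have h1 := (h.comp_right (Sum.elim id id : ℕ ⊕ ℕ → ℕ)).comp_left
    (Sum.elim (fun _ => ContinuousLinearMap.fst ℝ ℝ ℝ) fun _ => ContinuousLinearMap.snd ℝ ℝ ℝ)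
  convert! h1 using 1
  funext t ω
  rcases t with n | n <;> rfl

lemma measurable_window {y : ℕ → Ω → ℝ} (hy : ∀ k, 1 ≤ k → Measurable (y k)) {i : ℕ}
    (hi : 1 ≤ i) (n : ℕ) : Measurable (window y i n) :=
  measurable_pi_lambda _ fun j => hy (i + j) (by omega)

theorem exists_regression_of_not_grangerCauses [IsProbabilityMeasure μ] {x z : ℕ → Ω → ℝ}
    (hx_meas : ∀ k : ℕ, 1 ≤ k → Measurable (x k)) (hz_meas : ∀ k : ℕ, 1 ≤ k → Measurable (z k))
    {m : ℕ} (hgauss : IsGaussianProcess (pairProcess x z) μ)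
    (hnondeg : NoDeterministicRelation μ m x z)
    (hx_mean : ∀ k : ℕ, 1 ≤ k → ∫ ω, x k ω ∂μ = 0)
    (hz_mean : ∀ k : ℕ, 1 ≤ k → ∫ ω, z k ω ∂μ = 0)
    (hng : ¬ GrangerCauses μ m x z) {k : ℕ} (hk : m ≤ k) :
    ∃ b : Fin m → ℝ,
      (∀ j : Fin m, cov[z (k + 1), x (k - m + 1 + j); μ]
        = ∑ i : Fin m, b i * cov[z (k - m + 1 + i), x (k - m + 1 + j); μ]) ∧
      (∀ j : ℕ, 1 ≤ j → j ≤ k → cov[z (k + 1), z j; μ]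
        = ∑ i : Fin m, b i * cov[z (k - m + 1 + i), z j; μ]) := by
  have hlaw : CondLawEq μ (z (k + 1))
      (fun ω => (window x (k - m + 1) m ω, window z (k - m + 1) m ω)) (window z 1 k) := by
    by_contra h
    exact hng ⟨k, hk, h⟩
  have hP := isGaussianProcess_scalarProcess hgauss
  set P := scalarProcess x z with hPdef
  have hP0 : ∀ t, ∫ ω, P t ω ∂μ = 0 := by
    rintro (n | n)
    · exact hx_mean _ (by omega)
    · exact hz_mean _ (by omega)
  have hL2 : ∀ t, MemLp (P t) 2 μ := fun t => (hP.hasGaussianLaw_eval t).memLp_two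
  -- Index `n` of `scalarProcess` is time `n + 1`: the windows start at index `k - m`, and the
  -- target `z (k + 1)` is `.inr k`.
  let f : Fin m ⊕ Fin m → ℕ ⊕ ℕ := Sum.map (fun i => k - m + i) fun i => k - m + i
  let g : Fin k → ℕ ⊕ ℕ := fun j => Sum.inr j
  have hfl : ∀ i : Fin m, P (f (.inl i)) = x (k - m + 1 + i) := fun i => by
    simp only [f, hPdef, scalarProcess, Sum.map_inl, Sum.elim_inl]
    congr 1; omega
  have hfr : ∀ i : Fin m, P (f (.inr i)) = z (k - m + 1 + i) := fun i => by
    simp only [f, hPdef, scalarProcess, Sum.map_inr, Sum.elim_inr]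
    congr 1; omega
  have hgj : ∀ j : Fin k, P (g j) = z (1 + j) := fun j => by
    simp only [g, hPdef, scalarProcess, Sum.elim_inr]
    congr 1; omega
  let e : Fin m → Fin k := fun i => ⟨k - m + i, by omega⟩
  have he : Function.Injective e := fun i j h => by
    have := congrArg Fin.val h
    simp only [e] at this
    ext; omega
  have hze : ∀ i : Fin m, z (k - m + 1 + i) = z (1 + e i) := fun i => by
    congr 1; simp only [e]; omega
  have hext : ∀ (b : Fin m → ℝ) (F : Fin k → ℝ),
      ∑ j, (∑ i, if e i = j then b i else 0) * F j = ∑ i, b i * F (e i) := by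
    intro b F
    simp_rw [Finset.sum_mul]
    rw [Finset.sum_comm]
    simp
  have hext' : ∀ (b : Fin m → ℝ) (l : Fin m), (∑ i, if e i = e l then b i else 0) = b l := by
    intro b l
    simp [he.eq_iff]
  have hndU : ∀ (a : Fin m ⊕ Fin m → ℝ) (c : ℝ), (∀ᵐ ω ∂μ, ∑ i, a i * P (f i) ω = c) → a = 0 := by
    intro a c h
    obtain ⟨h1, h2⟩ := hnondeg k hk (fun i => a (.inl i))
      (fun j => ∑ i, if e i = j then a (.inr i) else 0) c (by
        filter_upwards [h] with ω hω
        rw [hext, ← hω, Fintype.sum_sum_type]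
        simp only [hfl, hfr, hze, window])
    funext i
    rcases i with i | i
    · exact congrFun h1 i
    · have := congrFun h2 (e i)
      simp only [hext'] at this
      exact this
  have hndV : ∀ (d : Fin k → ℝ) (c : ℝ), (∀ᵐ ω ∂μ, ∑ j, d j * P (g j) ω = c) → d = 0 := by
    intro d c h
    refine (hnondeg k hk 0 d c ?_).2
    filter_upwards [h] with ω hω
    rw [← hω]
    simp only [hgj, window, Pi.zero_apply, zero_mul, Finset.sum_const_zero, zero_add]
  obtain ⟨a, ha⟩ := exists_regression (fun i => hL2 (f i)) (z (k + 1)) hndU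
  obtain ⟨d, hd⟩ := exists_regression (fun j => hL2 (g j)) (z (k + 1)) hndV
  have hU : Measurable fun ω => (window x (k - m + 1) m ω, window z (k - m + 1) m ω) :=
    (measurable_window hx_meas (by omega) m).prodMk (measurable_window hz_meas (by omega) m)
  have hV : Measurable (window z 1 k) := measurable_window hz_meas le_rfl k
  have hcU := condExp_eq_regression hP hP0 (.inr k) f hU
    (φ := fun w => (fun i => w (.inl i), fun i => w (.inr i))) (by fun_prop)
    (by
      funext ω
      simp only [hfl, hfr]
      rfl)
    (ψ := Sum.elim (fun i p => p.1 i) fun i p => p.2 i)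
    (by rintro (i | i) <;> simp only [Sum.elim_inl, Sum.elim_inr] <;> fun_prop)
    (by
      rintro (i | i)
      · rw [hfl]; rfl
      · rw [hfr]; rfl)
    (hz_meas (k + 1) (by omega)) ha
  have hcV := condExp_eq_regression hP hP0 (.inr k) g hV
    (φ := fun w => w) (by fun_prop)
    (by
      funext ω
      simp only [hgj]
      rfl)
    (ψ := fun j p => p j) (by fun_prop)
    (by
      intro j
      rw [hgj]; rfl)
    (hz_meas (k + 1) (by omega)) hd
  have hce := condExp_eq_of_condLawEq hU hV
    (hP.hasGaussianLaw_eval (.inr k)).integrable hlaw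
  -- Subtracting the two regressions gives an affine relation between the `x`-window and `z^k`.
  -- Hence the `x`-coefficients vanish, and `d` is the window's `z`-coefficients extended by zero.
  obtain ⟨h1, h2⟩ := hnondeg k hk (fun i => a (.inl i))
    (fun j => (∑ i, if e i = j then a (.inr i) else 0) - d j) 0 (by
      filter_upwards [hcU, hcV, hce] with ω w1 w2 w3
      have w4 := w1.symm.trans (w3.trans w2)
      rw [Fintype.sum_sum_type] at w4
      simp only [hfl, hfr, hgj, hze] at w4
      simp_rw [sub_mul]
      rw [Finset.sum_sub_distrib, hext]
      simp only [window]
      linarith)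
  refine ⟨fun i => a (.inr i), fun j => ?_, fun j hj1 hjk => ?_⟩
  · have := ha (.inl j)
    rw [Fintype.sum_sum_type] at this
    simp only [hfl, hfr] at this
    rw [this]
    have h0 : ∀ i, a (.inl i) = 0 := fun i => congrFun h1 i
    simp [h0]
  · have := hd ⟨j - 1, by omega⟩
    have hj : z (1 + ((⟨j - 1, by omega⟩ : Fin k) : ℕ)) = z j := by
      congr 1; simp only; omega
    simp only [hgj, hj] at this
    rw [this]
    have h0 : ∀ j, d j = ∑ i, if e i = j then a (.inr i) else 0 := fun j =>
      (sub_eq_zero.1 (congrFun h2 j)).symm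
    simp_rw [h0]
    rw [hext _ fun l => cov[z (1 + l), z j; μ]]
    simp_rw [hze]

lemma stdDev_eq_of_jointlyStationary {x z : ℕ → Ω → ℝ}
    (hx_meas : ∀ k : ℕ, 1 ≤ k → Measurable (x k)) (hz_meas : ∀ k : ℕ, 1 ≤ k → Measurable (z k))
    (hstat : JointlyStationary μ x z) {i : ℕ} (hi : 1 ≤ i) : stdDev μ (z i) = stdDev μ (z 1) := by
  have hm : ∀ n, Measurable (pairProcess x z n) := fun n =>
    (hx_meas (n + 1) (by omega)).prodMk (hz_meas (n + 1) (by omega))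
  have h := congrArg (fun ν => Measure.map (fun s : ℕ → ℝ × ℝ => (s 0).2) ν) (hstat (i - 1))
  rw [Measure.map_map (by fun_prop) (measurable_pi_lambda _ hm),
    Measure.map_map (by fun_prop) (measurable_pi_lambda _ fun n => hm (i - 1 + n))] at h
  have h1 : (fun s : ℕ → ℝ × ℝ => (s 0).2) ∘ (fun ω n => pairProcess x z n ω) = z 1 := rfl
  have h2 : (fun s : ℕ → ℝ × ℝ => (s 0).2) ∘ (fun ω n => pairProcess x z (i - 1 + n) ω) = z i := by
    funext ω
    simp only [Function.comp_apply, pairProcess]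
    congr 1; omega
  rw [h1, h2] at h
  have hv : ∀ j, 1 ≤ j → Var[z j; μ] = Var[id; μ.map (z j)] := fun j hj => by
    rw [variance_map aemeasurable_id (hz_meas j hj).aemeasurable, Function.id_comp]
  rw [stdDev, stdDev, hv i hi, hv 1 le_rfl, h]

/-! ### Row and column sums of the perturbation, and the left null vector -/

lemma sum_ite_eq_add_sub {n : ℕ} (i : Fin n) (s t : ℝ) :
    ∑ j, (if i = j then t else s) = n * s + (t - s) := by
  have : ∀ j, (if i = j then t else s) = s + if i = j then t - s else 0 := fun j => by
    split_ifs <;> ring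
  simp_rw [this]
  rw [Finset.sum_add_distrib, Finset.sum_ite_eq]
  simp

lemma sum_fin_le {n : ℕ} {F : Fin n → ℝ} {t : ℝ} (h : ∀ j, F j ≤ t) : ∑ j, F j ≤ n * t := by
  simpa using Finset.sum_le_card_nsmul Finset.univ F t fun j _ => h j

section Norms

variable {x z x' z' : ℕ → Ω → ℝ} {m q k : ℕ} {t1 t2 t3 : ℝ}

/-- A row meets a variance entry once, except the last: time `k + 1` is not among the columns, so
all its `z`-entries have nonzero lag. This is the source of `max t1 t3`. -/
lemma sum_row_abs_covMatrix_sub_le (hmq : m ≤ q) (hqk : q ≤ k)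
    (h2 : ∀ i j, 1 ≤ i → 1 ≤ j → |cov[z' i, x' j; μ] - cov[z i, x j; μ]| ≤ t2)
    (h1 : ∀ i j, 1 ≤ i → 1 ≤ j → i ≠ j → |cov[z' i, z' j; μ] - cov[z i, z j; μ]| ≤ t1)
    (h3 : ∀ i, 1 ≤ i → |cov[z' i, z' i; μ] - cov[z i, z i; μ]| ≤ t3) (i : Fin (m + 1)) :
    ∑ j, |covMatrix μ x' z' m q k i j - covMatrix μ x z m q k i j| ≤ NInf m q t1 t2 t3 := by
  rw [Fintype.sum_sum_type, Fintype.sum_sum_type]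
  have hx : ∀ j : Fin m, |covMatrix μ x' z' m q k i (.inl j) - covMatrix μ x z m q k i (.inl j)|
      ≤ t2 := fun j => h2 _ _ (by omega) (by omega)
  have ho : ∀ j : Fin (q - m), |covMatrix μ x' z' m q k i (.inr (.inr j))
      - covMatrix μ x z m q k i (.inr (.inr j))| ≤ t1 := fun j =>
    h1 _ _ (by omega) (by omega) (by omega)
  have hz : ∑ j : Fin m, |covMatrix μ x' z' m q k i (.inr (.inl j))
      - covMatrix μ x z m q k i (.inr (.inl j))| ≤ (m - 1) * t1 + max t1 t3 := by
    by_cases hi : (i : ℕ) < m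
    · have hb : ∀ j : Fin m, |covMatrix μ x' z' m q k i (.inr (.inl j))
          - covMatrix μ x z m q k i (.inr (.inl j))| ≤ if ⟨i, hi⟩ = j then t3 else t1 := by
        intro j
        split_ifs with hij
        · subst hij
          exact h3 _ (by omega)
        · refine h1 _ _ (by omega) (by omega) fun h => hij (Fin.ext ?_)
          simp only
          omega
      refine (Finset.sum_le_sum fun j _ => hb j).trans ?_
      rw [sum_ite_eq_add_sub]
      linarith [le_max_right t1 t3]
    · refine (sum_fin_le (t := t1) fun j => h1 _ _ (by omega) (by omega) (by omega)).trans ?_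
      linarith [le_max_left t1 t3]
  have hx' := sum_fin_le hx
  have ho' := sum_fin_le ho
  rw [Nat.cast_sub hmq] at ho'
  unfold NInf
  linarith

lemma sum_col_abs_covMatrix_sub_le (hqk : q ≤ k)
    (h2 : ∀ i j, 1 ≤ i → 1 ≤ j → |cov[z' i, x' j; μ] - cov[z i, x j; μ]| ≤ t2)
    (h1 : ∀ i j, 1 ≤ i → 1 ≤ j → i ≠ j → |cov[z' i, z' j; μ] - cov[z i, z j; μ]| ≤ t1)
    (h3 : ∀ i, 1 ≤ i → |cov[z' i, z' i; μ] - cov[z i, z i; μ]| ≤ t3)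
    (j : Fin m ⊕ (Fin m ⊕ Fin (q - m))) :
    ∑ i, |covMatrix μ x' z' m q k i j - covMatrix μ x z m q k i j| ≤ NOne m t1 t2 t3 := by
  unfold NOne
  rcases j with j | j | j
  · refine (sum_fin_le (t := t2) fun i => h2 _ _ (by omega) (by omega)).trans ?_
    push_cast
    rw [mul_comm]
    exact (le_max_left _ _).trans (le_max_right _ _)
  · have hb : ∀ i : Fin (m + 1), |covMatrix μ x' z' m q k i (.inr (.inl j))
        - covMatrix μ x z m q k i (.inr (.inl j))| ≤ if j.castSucc = i then t3 else t1 := by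
      intro i
      split_ifs with hij
      · subst hij
        exact h3 _ (by omega)
      · refine h1 _ _ (by omega) (by omega) fun h => hij (Fin.ext ?_)
        simp only [Fin.val_castSucc]
        omega
    refine (Finset.sum_le_sum fun i _ => hb i).trans ?_
    rw [sum_ite_eq_add_sub]
    refine le_trans (le_of_eq ?_) ((le_max_right _ _).trans (le_max_right _ _))
    push_cast
    ring
  · refine (sum_fin_le (t := t1) fun i => h1 _ _ (by omega) (by omega) (by omega)).trans ?_
    push_cast
    rw [mul_comm]
    exact le_max_left _ _

end Norms

/-- The null vector is `(-b, 1)`: it forms the residual of `z (k + 1)`, which is uncorrelated with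
every column variable. -/
lemma exists_left_null_covMatrix {x z : ℕ → Ω → ℝ} {m q k : ℕ} (hmq : m ≤ q) (hqk : q ≤ k)
    {b : Fin m → ℝ}
    (hx : ∀ j : Fin m, cov[z (k + 1), x (k - m + 1 + j); μ]
        = ∑ i : Fin m, b i * cov[z (k - m + 1 + i), x (k - m + 1 + j); μ])
    (hz : ∀ j : ℕ, 1 ≤ j → j ≤ k → cov[z (k + 1), z j; μ]
        = ∑ i : Fin m, b i * cov[z (k - m + 1 + i), z j; μ]) :
    ∃ u : Fin (m + 1) → ℝ, u ≠ 0 ∧ ∀ j, ∑ i, u i * covMatrix μ x z m q k i j = 0 := by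
  refine ⟨Fin.snoc (fun i => -b i) 1, fun h => ?_, fun j => ?_⟩
  · have := congrFun h (Fin.last m)
    simp at this
  · have hlast : z (k - m + 1 + ((Fin.last m : Fin (m + 1)) : ℕ)) = z (k + 1) := by
      congr 1; simp only [Fin.val_last]; omega
    have key : ∀ Y : Ω → ℝ, cov[z (k + 1), Y; μ] = ∑ i : Fin m, b i * cov[z (k - m + 1 + i), Y; μ] →
        ∑ i : Fin (m + 1), (Fin.snoc (fun i => -b i) 1 : Fin (m + 1) → ℝ) i
          * cov[z (k - m + 1 + i), Y; μ] = 0 := by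
      intro Y h
      rw [Fin.sum_univ_castSucc, hlast, h]
      simp
    rcases j with j | j | j
    · exact key (x (k - m + 1 + j)) (hx j)
    · exact key (z (k - m + 1 + j)) (hz _ (by omega) (by omega))
    · exact key (z (k - q + 1 + j)) (hz _ (by omega) (by omega))

end Granger

end

/-! ### Assembly of the contradiction -/

theorem proposition3 {Ω : Type*} [MeasurableSpace Ω] (μ : Measure Ω) [IsProbabilityMeasure μ]
    (x z : ℕ → Ω → ℝ)
    (hx_meas : ∀ k : ℕ, 1 ≤ k → Measurable (x k)) (hz_meas : ∀ k : ℕ, 1 ≤ k → Measurable (z k))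
    (m : ℕ) (hm : 1 ≤ m)
    (hgauss : IsGaussianProcess (Granger.pairProcess x z) μ)
    (hstat : Granger.JointlyStationary μ x z)
    (hmarkov : Granger.PartiallyMarkov μ m x z)
    (hnondeg : Granger.NoDeterministicRelation μ m x z)
    (hx_mean : ∀ k : ℕ, 1 ≤ k → ∫ ω, x k ω ∂μ = 0)
    (hz_mean : ∀ k : ℕ, 1 ≤ k → ∫ ω, z k ω ∂μ = 0)
    (lx ux lz uz ρxz ρzz Δx Δz : ℝ)
    (hlx : 0 < lx) (hlz : 0 < lz)
    (hx_sd : ∀ k : ℕ, 1 ≤ k → lx ≤ Granger.stdDev μ (x k) ∧ Granger.stdDev μ (x k) ≤ ux)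
    (hz_sd : ∀ k : ℕ, 1 ≤ k → lz ≤ Granger.stdDev μ (z k) ∧ Granger.stdDev μ (z k) ≤ uz)
    (hρxz : ∀ i j : ℕ, 1 ≤ i → 1 ≤ j → |Granger.corr μ (x i) (z j)| ≤ ρxz) (hρxz1 : ρxz < 1)
    (hρzz : ∀ i j : ℕ, 1 ≤ i → 1 ≤ j → i ≠ j → |Granger.corr μ (z i) (z j)| ≤ ρzz)
    (hρzz1 : ρzz < 1)
    (hΔx : 0 < Δx) (hΔz : 0 < Δz)
    (hΔx_lt : Δx < 2 * Real.pi * lx) (hΔz_lt : Δz < 2 * Real.pi * lz)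
    (q k : ℕ) (hmq : m ≤ q) (hqk : q ≤ k)
    (hrank : (Granger.covMatrix μ (Granger.quantized Δx x) (Granger.quantized Δz z) m q k).rank
      = m + 1)
    (hcond :
      √(Granger.NInf m q (Granger.varrho1 lz ρzz Δz) (Granger.varrho2 lx ux lz uz ρxz Δx Δz)
            (Granger.varrho3 lz uz Δz)
          * Granger.NOne m (Granger.varrho1 lz ρzz Δz) (Granger.varrho2 lx ux lz uz ρxz Δx Δz)
            (Granger.varrho3 lz uz Δz))
        < Granger.sigmaMin
            (Granger.covMatrix μ (Granger.quantized Δx x) (Granger.quantized Δz z) m q k)) :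
    Granger.GrangerCauses μ m x z := by
  by_contra hng
  obtain ⟨b, hbx, hbz⟩ := Granger.exists_regression_of_not_grangerCauses hx_meas hz_meas hgauss
    hnondeg hx_mean hz_mean hng (hmq.trans hqk)
  obtain ⟨u, hu, hnull⟩ := Granger.exists_left_null_covMatrix hmq hqk hbx hbz
  have hP := Granger.isGaussianProcess_scalarProcess hgauss
  have hpxz : ∀ i j, 1 ≤ i → 1 ≤ j → HasGaussianLaw (fun ω => (x i ω, z j ω)) μ := by
    intro i j hi hj
    obtain ⟨i, rfl⟩ := Nat.exists_eq_add_of_le' hi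
    obtain ⟨j, rfl⟩ := Nat.exists_eq_add_of_le' hj
    exact hP.hasGaussianLaw_prodMk (s := .inl i) (t := .inr j)
  have hpzz : ∀ i j, 1 ≤ i → 1 ≤ j → HasGaussianLaw (fun ω => (z i ω, z j ω)) μ := by
    intro i j hi hj
    obtain ⟨i, rfl⟩ := Nat.exists_eq_add_of_le' hi
    obtain ⟨j, rfl⟩ := Nat.exists_eq_add_of_le' hj
    exact hP.hasGaussianLaw_prodMk (s := .inr i) (t := .inr j)
  have hsd : ∀ i, 1 ≤ i → Granger.stdDev μ (z i) = Granger.stdDev μ (z 1) := fun i hi =>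
    Granger.stdDev_eq_of_jointlyStationary hx_meas hz_meas hstat hi
  have h2 : ∀ i j, 1 ≤ i → 1 ≤ j → |cov[Granger.quantized Δz z i, Granger.quantized Δx x j; μ]
      - cov[z i, x j; μ]| ≤ Granger.varrho2 lx ux lz uz ρxz Δx Δz := by
    intro i j hi hj
    rw [covariance_comm, covariance_comm (z i)]
    exact Granger.abs_covariance_quantizer_sub_le_varrho2 (hpxz j i hj hi) (hx_mean j hj)
      (hz_mean i hi) hlx hlz (hx_sd j hj) (hz_sd i hi) (hρxz j i hj hi) hρxz1 hΔx hΔz hΔx_lt hΔz_lt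
  have h1 : ∀ i j, 1 ≤ i → 1 ≤ j → i ≠ j →
      |cov[Granger.quantized Δz z i, Granger.quantized Δz z j; μ] - cov[z i, z j; μ]|
        ≤ Granger.varrho1 lz ρzz Δz := by
    intro i j hi hj hij
    exact Granger.abs_covariance_quantizer_sub_le_varrho1 (hpzz i j hi hj) (hz_mean i hi)
      (hz_mean j hj) hlz (hz_sd i hi).1 ((hsd j hj).trans (hsd i hi).symm) (hρzz i j hi hj hij)
      hρzz1 hΔz hΔz_lt
  have h3 : ∀ i, 1 ≤ i →
      |cov[Granger.quantized Δz z i, Granger.quantized Δz z i; μ] - cov[z i, z i; μ]|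
        ≤ Granger.varrho3 lz uz Δz := fun i hi =>
    Granger.abs_variance_quantizer_sub_le_varrho3 (hpzz i i hi hi).fst (hz_mean i hi) hlz
      (hz_sd i hi).1 hΔz hΔz_lt
  have : Nonempty (Fin m ⊕ (Fin m ⊕ Fin (q - m))) := ⟨.inl ⟨0, hm⟩⟩
  refine absurd hcond (not_lt.2 ?_)
  refine Granger.sigmaMin_le_of_left_null _ (Granger.covMatrix μ x z m q k) ?_
    (Granger.sum_row_abs_covMatrix_sub_le hmq hqk h2 h1 h3)
    (Granger.sum_col_abs_covMatrix_sub_le hqk h2 h1 h3) hu hnull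
  -- The matrix is at least as wide as tall, `m + 1 ≤ m + q`, so `sigmaMin` is the singular value of
  -- index `m`.
  simp only [Fintype.card_sum, Fintype.card_fin]
  omega
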